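/- Let $\lambda=(\lambda_n)$ be a frequency, i.e. a strictly increasing sequence of non-negative real numbers tending to $+\infty$, and assume that $\lambda$ satisfies Landau's condition $$(LC)\qquad \forall\,\delta>0\ \exists\, C>0\ \forall\, n:\quad \lambda_{n+1}-\lambda_n\ \ge\ C\,e^{-e^{\delta\lambda_n}} .$$ Let $(G,\beta)$ be a $\lambda$-Dirichlet group: $G$ is a compact (Hausdorff) abelian group with normalized Haar measure, $\beta:(\mathbb R,+)\to G$ is a continuous homomorphism with dense range, and for every $n$ there is a (necessarily unique) continuous character $h_{\lambda_n}:G\to\mathbb T$ with $h_{\lambda_n}(\beta(t))=e^{-i\lambda_n t}$ for all $t\in\mathbb R$. Let $H_1^\lambda(G)$ be the space of all $f\in L_1(G)$ whose Fourier coefficients $\widehat f(h)=\int_G f\,\overline{h}$ vanish at every continuous character $h\notin\{h_{\lambda_n}: n\in\mathbb N\}$, and let $\mathcal H_1(\lambda)$ be the space of all formal series $D=\sum a_n e^{-\lambda_n s}$ for which there is $f\in H_1^\lambda(G)$ with $a_n=\widehat f(h_{\lambda_n})$ for all $n$; this $f$ is then said to be associated to $D$. For $\omega\in G$ let $D^\omega=\sum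 a_n h_{\lambda_n}(\omega)e^{-\lambda_n s}$ be the corresponding vertical limit of $D$, and let $f_\omega(t)=f(\omega\beta(t))$, $t\in\mathbb R$. For $u>0$ let $P_u(t)=\frac1\pi\frac{u}{u^2+t^2}$ be the Poisson kernel. Let $D=\sum a_ne^{-\lambda_ns}\in\mathcal H_1(\lambda)$. Then: (i) For almost all $\omega\in G$ the vertical limit $D^\omega$ converges at every point of the open half-plane $[\operatorname{Re}>0]$. (ii) More precisely, if $f\in H_1^\lambda(G)$ is the function associated to $D$, then there is a null set $N\subset G$ such that for every $\omega\notin N$ the series $D^\omega$ converges on $[\operatorname{Re}>0]$, $f_\omega$ is locally integrable on $\mathbb R$, and for every $u>0$ and almost every $t\in\mathbb R$ the convolution integral $(f_\omega * P_u)(t)=\int_{\mathbb R} f_\omega(x)P_u(t-x)\,dx$ converges absolutely and $$D^\omega(u+it)=(f_\omega * P_u)(t).$$ -/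

import Mathlib

open MeasureTheory Filter Topology

noncomputable section

namespace GenDirichlet

/-- A frequency: a strictly increasing sequence of non-negative reals tending to `+∞`. -/
structure IsFrequency (lam : ℕ → ℝ) : Prop where
  strictMono : StrictMono lam
  nonneg : ∀ n, 0 ≤ lam n
  tendsto : Tendsto lam atTop atTop

/-- Landau's condition (LC). -/
def LandauCondition (lam : ℕ → ℝ) : Prop :=
  ∀ δ : ℝ, 0 < δ → ∃ C : ℝ, 0 < C ∧
    ∀ n : ℕ, C * Real.exp (-Real.exp (δ * lam n)) ≤ lam (n + 1) - lam n

/-- The general Dirichlet series `∑ aₙ e^{-λₙ s}` converges at `s` with sum `l`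
(convergence of the sequence of partial sums). -/
def SeriesConvergesTo (lam : ℕ → ℝ) (a : ℕ → ℂ) (s l : ℂ) : Prop :=
  Tendsto (fun N : ℕ => ∑ n ∈ Finset.range N, a n * Complex.exp (-(lam n : ℂ) * s))
    atTop (𝓝 l)

/-- The Dirichlet series `∑ aₙ e^{-λₙ s}` converges at every point of `[Re > 0]`. -/
def ConvergesOnRightHalfPlane (lam : ℕ → ℝ) (a : ℕ → ℂ) : Prop :=
  ∀ s : ℂ, 0 < s.re → ∃ l : ℂ, SeriesConvergesTo lam a s l

/-- The Poisson kernel `P_u(t) = (1/π) u / (u² + t²)` on the real line. -/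
def poisson (u t : ℝ) : ℝ := 1 / Real.pi * (u / (u ^ 2 + t ^ 2))

section Group

variable {G : Type*} [CommGroup G] [TopologicalSpace G]

/-- `(G, β)` is a Dirichlet group: `β : (ℝ, +) → G` is a continuous homomorphism with
dense range. -/
structure IsDirichletGroup (β : Multiplicative ℝ →* G) : Prop where
  continuous : Continuous β
  denseRange : DenseRange β

/-- The continuous character `h` of `G` satisfies `h ∘ β = e^{-i x ·}`. -/
def RestrictsTo (β : Multiplicative ℝ →* G) (x : ℝ) (h : G →ₜ* Circle) : Prop :=
  ∀ t : ℝ, (h (β (Multiplicative.ofAdd t)) : ℂ) = Complex.exp (-Complex.I * x * t)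

/-- `(G, β)` is a `λ`-Dirichlet group: a Dirichlet group such that every `e^{-i λₙ ·}` is of the
form `h ∘ β` for some continuous character `h` of `G`. -/
structure IsFreqDirichletGroup (lam : ℕ → ℝ) (β : Multiplicative ℝ →* G) : Prop
    extends IsDirichletGroup β where
  exists_char : ∀ n, ∃ h : G →ₜ* Circle, RestrictsTo β (lam n) h

/-- The character `h_{λₙ}`, see `freqChar_restrictsTo` and `eq_freqChar`. -/
def freqChar {lam : ℕ → ℝ} {β : Multiplicative ℝ →* G} (hβ : IsFreqDirichletGroup lam β)
    (n : ℕ) : G →ₜ* Circle :=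
  (hβ.exists_char n).choose

theorem freqChar_restrictsTo {lam : ℕ → ℝ} {β : Multiplicative ℝ →* G}
    (hβ : IsFreqDirichletGroup lam β) (n : ℕ) : RestrictsTo β (lam n) (freqChar hβ n) :=
  (hβ.exists_char n).choose_spec

theorem eq_freqChar {lam : ℕ → ℝ} {β : Multiplicative ℝ →* G}
    (hβ : IsFreqDirichletGroup lam β) (n : ℕ) (h : G →ₜ* Circle)
    (hh : RestrictsTo β (lam n) h) : h = freqChar hβ n := by
  have key : (h : G → Circle) = freqChar hβ n := by
    refine hβ.denseRange.equalizer h.continuous_toFun (freqChar hβ n).continuous_toFun ?_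
    funext t
    exact Circle.ext ((hh t.toAdd).trans (freqChar_restrictsTo hβ n t.toAdd).symm)
  exact DFunLike.coe_injective key

/-- The coefficients `aₙ h_{λₙ}(ω)` of the vertical limit `D^ω` of `D = ∑ aₙ e^{-λₙ s}`. -/
def verticalLimit {lam : ℕ → ℝ} {β : Multiplicative ℝ →* G} (hβ : IsFreqDirichletGroup lam β)
    (a : ℕ → ℂ) (ω : G) (n : ℕ) : ℂ :=
  a n * (freqChar hβ n ω : ℂ)

/-- The restriction `f_ω(t) = f(ω β(t))` of `f : G → ℂ` to the real line. -/
def restrict (β : Multiplicative ℝ →* G) (f : G → ℂ) (ω : G) (t : ℝ) : ℂ :=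
  f (ω * β (Multiplicative.ofAdd t))

variable [IsTopologicalGroup G] [CompactSpace G] [MeasurableSpace G] [BorelSpace G]

/-- The normalized Haar measure of the compact group `G`. -/
def haarProb (G : Type*) [CommGroup G] [TopologicalSpace G] [IsTopologicalGroup G]
    [CompactSpace G] [MeasurableSpace G] [BorelSpace G] : Measure G :=
  Measure.haarMeasure (⊤ : TopologicalSpace.PositiveCompacts G)

/-- The Fourier coefficient of `f : G → ℂ` at the character `h`. -/
def fourierCoeff (f : G → ℂ) (h : G →ₜ* Circle) : ℂ :=
  ∫ ω, f ω * (starRingEnd ℂ) (h ω : ℂ) ∂(haarProb G)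

/-- `f` belongs to the Hardy space `H_1^λ(G)`: it is in `L_1(G)` and its Fourier transform is
supported on `{h_{λₙ} | n ∈ ℕ}`. -/
structure MemHardyOne {lam : ℕ → ℝ} {β : Multiplicative ℝ →* G}
    (hβ : IsFreqDirichletGroup lam β) (f : G → ℂ) : Prop where
  memLp : MemLp f 1 (haarProb G)
  fourier_support : ∀ h : G →ₜ* Circle, h ∉ Set.range (freqChar hβ) → fourierCoeff f h = 0

/-- `D = ∑ aₙ e^{-λₙ s}` is the Bohr transform of `f ∈ H_1^λ(G)`. -/
structure IsAssociated {lam : ℕ → ℝ} {β : Multiplicative ℝ →* G}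
    (hβ : IsFreqDirichletGroup lam β) (a : ℕ → ℂ) (f : G → ℂ) : Prop where
  mem : MemHardyOne hβ f
  coeff : ∀ n, a n = fourierCoeff f (freqChar hβ n)

/-- The space `𝓗_1(λ)` of `λ`-Dirichlet series (given by their coefficients), realized on the
`λ`-Dirichlet group `(G, β)`. -/
def dirichletHardyOne {lam : ℕ → ℝ} {β : Multiplicative ℝ →* G}
    (hβ : IsFreqDirichletGroup lam β) : Set (ℕ → ℂ) :=
  {a | ∃ f : G → ℂ, IsAssociated hβ a f}

end Group

end GenDirichlet

end

/-! Along an orbit of `β`, partial sums become convolutions. If an integrable kernel K on the line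
has Fourier transform 1 at λ_0, …, λ_N and 0 at all later frequencies, then ω ↦ ∫ f(ωβ(t)) K(t) dt
and the N-th partial sum of the coefficients of D^ω have the same Fourier coefficients on G, hence
agree almost everywhere (`sum_verticalLimit_ae_eq_lineConv`). A difference of two Fejér-type
kernels, with trapezoidal transform falling from 1 to 0 inside the gap (λ_N, λ_{N+1}), does this.

The crucial estimate is `abs_trapezoidKernel_le`. These kernels are all dominated by one integrable
weight, and the ramp width h enters the constant only through (1 + log(1 + 1/h))². Landau's
condition bounds log(1/h) by a constant plus e^{δλ_N}, so the constant is at most M e^{δλ_N} for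
every δ > 0 (`exists_partialSum_kernel`). Hence the N-th partial sum of D^ω at s = 0 is at most M
e^{δλ_N} times `majorant`, the weighted integral of |f_ω|, which is integrable over G and does not
depend on N. No maximal inequality is needed: summation by parts gives convergence on Re s ≥ 2δ, and
δ is arbitrary.

For fixed u > 0 the same majorant dominates the partial sums at u, so Fourier coefficients pass to
the limit and the sum is the Poisson integral of f for almost every ω (`ae_tsum_abelTerm_eq`).
Rational u and continuity in u make the null set independent of u. Moving ω along its orbit turns u
into u + it.

Integrable functions on G are determined by their Fourier coefficients because characters separate
points. This comes from Gelfand theory for the commuting, adjoint-stable family of convolution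
operators on L²(G), and Stone–Weierstrass then makes trigonometric polynomials dense. -/

noncomputable section

namespace GenDirichlet

/-! ### Convolution operators on L² of a compact abelian group. -/

section Convolution

variable {G : Type*} [CommGroup G] [TopologicalSpace G] [IsTopologicalGroup G]

/-- The function `y ↦ φ (x y⁻¹)`, depending continuously on `x`. -/
def slice (φ : C(G, ℂ)) : C(G, C(G, ℂ)) :=
  ContinuousMap.curry ⟨fun p : G × G => φ (p.1 * p.2⁻¹), by fun_prop⟩

@[simp] theorem slice_apply (φ : C(G, ℂ)) (x y : G) : slice φ x y = φ (x * y⁻¹) := rfl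

/-- The function `y ↦ φ (x y)`, depending continuously on `x`. -/
def translate (φ : C(G, ℂ)) : C(G, C(G, ℂ)) :=
  ContinuousMap.curry ⟨fun p : G × G => φ (p.1 * p.2), by fun_prop⟩

@[simp] theorem translate_apply (φ : C(G, ℂ)) (x y : G) : translate φ x y = φ (x * y) := rfl

/-- The function `x ↦ conj (φ (x⁻¹))`. -/
def reflect (φ : C(G, ℂ)) : C(G, ℂ) := star (φ.comp ⟨fun x => x⁻¹, continuous_inv⟩)

@[simp] theorem reflect_apply (φ : C(G, ℂ)) (x : G) : reflect φ x = starRingEnd ℂ (φ x⁻¹) := rfl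

variable [CompactSpace G] [MeasurableSpace G] [BorelSpace G]

instance : (haarProb G).IsHaarMeasure := by unfold haarProb; infer_instance

instance : (haarProb G).Regular := by unfold haarProb; infer_instance

instance : IsProbabilityMeasure (haarProb G) :=
  ⟨by simpa [haarProb] using
    Measure.haarMeasure_self (K₀ := (⊤ : TopologicalSpace.PositiveCompacts G))⟩

theorem integrable_continuousMap (φ : C(G, ℂ)) : Integrable φ (haarProb G) :=
  φ.continuous.integrable_of_hasCompactSupport (HasCompactSupport.of_compactSpace _)

/-- Convolution of continuous functions on a compact group. -/
def conv (φ ψ : C(G, ℂ)) : C(G, ℂ) where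
  toFun x := ∫ y, φ (x * y⁻¹) * ψ y ∂(haarProb G)
  continuous_toFun := by
    rw [← continuousOn_univ]
    refine continuousOn_integral_of_compact_support (k := Set.univ) isCompact_univ ?_ (by simp)
    apply Continuous.continuousOn
    simp only [Function.uncurry_def]
    fun_prop

theorem conv_apply (φ ψ : C(G, ℂ)) (x : G) :
    conv φ ψ x = ∫ y, φ (x * y⁻¹) * ψ y ∂(haarProb G) := rfl

theorem conv_comm (φ ψ : C(G, ℂ)) : conv φ ψ = conv ψ φ := by
  ext x
  rw [conv_apply, conv_apply, ← integral_inv_eq_self, ← integral_mul_left_eq_self _ x⁻¹]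
  refine integral_congr_ae (.of_forall fun y => ?_)
  simp only [mul_inv_rev, inv_inv]
  rw [mul_comm, mul_comm y⁻¹ x]
  congr 2
  rw [mul_comm x⁻¹ y, mul_comm y, mul_inv_cancel_left]

theorem conv_translate_left (φ ψ : C(G, ℂ)) (x : G) :
    conv (translate φ x) ψ = translate (conv φ ψ) x := by
  ext y
  simp [conv_apply, mul_assoc]

theorem conv_translate_right (φ ψ : C(G, ℂ)) (x : G) :
    conv φ (translate ψ x) = translate (conv φ ψ) x := by
  rw [conv_comm, conv_translate_left, conv_comm]

theorem integral_swap {f : G → G → ℂ} (hf : Continuous f.uncurry) :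
    ∫ x, ∫ y, f x y ∂(haarProb G) ∂(haarProb G) = ∫ y, ∫ x, f x y ∂(haarProb G) ∂(haarProb G) :=
  integral_integral_swap_of_hasCompactSupport hf (HasCompactSupport.of_compactSpace _)

theorem conv_assoc (φ ψ η : C(G, ℂ)) : conv (conv φ ψ) η = conv φ (conv ψ η) := by
  ext x
  simp only [conv_apply, ← integral_const_mul, ← integral_mul_const]
  rw [integral_swap (f := fun y z => φ (x * y⁻¹) * (ψ (y * z⁻¹) * η z))]
  · refine integral_congr_ae (.of_forall fun z => ?_)
    dsimp only
    rw [← integral_mul_right_eq_self (fun y => φ (x * y⁻¹) * (ψ (y * z⁻¹) * η z)) z]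
    refine integral_congr_ae (.of_forall fun y => ?_)
    simp only [mul_inv_rev, mul_assoc, mul_inv_cancel, mul_one]
  · simp only [Function.uncurry_def]
    fun_prop

theorem conv_left_comm (φ ψ η : C(G, ℂ)) : conv φ (conv ψ η) = conv ψ (conv φ η) := by
  rw [← conv_assoc, conv_comm φ, conv_assoc]

/-- The operator `ψ ↦ φ * ψ` as a linear map on continuous functions. -/
def convₗ (φ : C(G, ℂ)) : C(G, ℂ) →ₗ[ℂ] C(G, ℂ) where
  toFun := conv φ
  map_add' ψ η := by
    ext x
    simp only [conv_apply, ContinuousMap.add_apply, mul_add]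
    exact integral_add (integrable_continuousMap (slice φ x * ψ))
      (integrable_continuousMap (slice φ x * η))
  map_smul' c ψ := by
    ext x
    simp only [conv_apply, ContinuousMap.smul_apply, smul_eq_mul, RingHom.id_apply,
      ← integral_const_mul]
    congr 1 with y
    ring

/-- The inclusion of `C(G)` into `L²(G)`. -/
abbrev toL2 : C(G, ℂ) →L[ℂ] Lp ℂ 2 (haarProb G) := ContinuousMap.toLp 2 (haarProb G) ℂ

theorem denseRange_toL2 : DenseRange (toL2 (G := G)) :=
  ContinuousMap.toLp_denseRange ℂ (haarProb G) ℂ (by simp)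

theorem inner_toL2 (φ ψ : C(G, ℂ)) :
    inner ℂ (toL2 φ) (toL2 ψ) = ∫ x, starRingEnd ℂ (φ x) * ψ x ∂(haarProb G) := by
  rw [ContinuousMap.inner_toLp]
  congr 1 with x
  ring

/-- By Cauchy–Schwarz against a slice of φ, even the sup norm of φ * ψ is controlled by the L² norm
of ψ. The linear dependence on the sup norm of φ is what makes `convL2` continuous, and later the
characters built from it. -/
theorem norm_conv_le (φ ψ : C(G, ℂ)) :
    ‖toL2 (conv φ ψ)‖ ≤ (‖toL2 (G := G)‖ ^ 2 * ‖φ‖) * ‖toL2 ψ‖ := by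
  have h : ‖conv φ ψ‖ ≤ ‖toL2 (G := G)‖ * ‖φ‖ * ‖toL2 ψ‖ := by
    refine (ContinuousMap.norm_le _ (by positivity)).2 fun x => ?_
    have : conv φ ψ x = inner ℂ (toL2 (star (slice φ x))) (toL2 ψ) := by
      rw [inner_toL2, conv_apply]
      simp
    rw [this]
    refine (norm_inner_le_norm _ _).trans ?_
    gcongr
    refine (ContinuousLinearMap.le_opNorm _ _).trans ?_
    gcongr
    rw [norm_star]
    exact (ContinuousMap.norm_le _ (norm_nonneg _)).2 fun y => φ.norm_coe_le_norm _
  calc _ ≤ ‖toL2 (G := G)‖ * ‖conv φ ψ‖ := ContinuousLinearMap.le_opNorm _ _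
    _ ≤ ‖toL2 (G := G)‖ * (‖toL2 (G := G)‖ * ‖φ‖ * ‖toL2 ψ‖) := by gcongr
    _ = _ := by ring

/-- The operator of convolution with `φ` on `L²(G)`. -/
def convL2 (φ : C(G, ℂ)) : Lp ℂ 2 (haarProb G) →L[ℂ] Lp ℂ 2 (haarProb G) :=
  LinearMap.extendOfNorm ((toL2 (G := G)).toLinearMap ∘ₗ convₗ φ) (toL2 (G := G)).toLinearMap

theorem convL2_toL2 (φ ψ : C(G, ℂ)) : convL2 φ (toL2 ψ) = toL2 (conv φ ψ) :=
  LinearMap.extendOfNorm_eq (e := (toL2 (G := G)).toLinearMap) denseRange_toL2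
    ⟨_, norm_conv_le φ⟩ ψ

theorem norm_convL2_le (φ : C(G, ℂ)) : ‖convL2 φ‖ ≤ ‖toL2 (G := G)‖ ^ 2 * ‖φ‖ :=
  LinearMap.opNorm_extendOfNorm_le (e := (toL2 (G := G)).toLinearMap) denseRange_toL2
    (by positivity) (norm_conv_le φ)

theorem ext_toL2 {E : Type*} [NormedAddCommGroup E] [NormedSpace ℂ E]
    {S T : Lp ℂ 2 (haarProb G) →L[ℂ] E} (h : ∀ ψ : C(G, ℂ), S (toL2 ψ) = T (toL2 ψ)) : S = T :=
  ContinuousLinearMap.coeFn_injective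
    (denseRange_toL2.equalizer S.continuous T.continuous (funext h))

theorem convL2_sub (φ ψ : C(G, ℂ)) : convL2 (φ - ψ) = convL2 φ - convL2 ψ := by
  refine ext_toL2 fun η => ?_
  rw [sub_apply, convL2_toL2, convL2_toL2, convL2_toL2, conv_comm,
    conv_comm φ, conv_comm ψ, ← map_sub]
  exact congrArg _ (map_sub (convₗ η) φ ψ)

theorem continuous_convL2 : Continuous (convL2 (G := G)) := by
  refine (LipschitzWith.of_dist_le_mul (K := ⟨‖toL2 (G := G)‖ ^ 2, by positivity⟩)
    fun φ ψ => ?_).continuous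
  rw [dist_eq_norm, dist_eq_norm, ← convL2_sub]
  exact norm_convL2_le _

theorem commute_convL2 (φ ψ : C(G, ℂ)) : Commute (convL2 φ) (convL2 ψ) := by
  refine ext_toL2 fun η => ?_
  simp only [mul_apply_eq_comp, convL2_toL2, conv_left_comm φ ψ]

/-- Translations can be moved from one factor of a convolution to the other. A multiplicative
functional applied to this identity yields a homomorphism on G. -/
theorem convL2_translate_mul (φ ψ : C(G, ℂ)) (x y : G) :
    convL2 (translate φ x) * convL2 (translate ψ y) = convL2 (translate φ (x * y)) * convL2 ψ := by
  refine ext_toL2 fun η => ?_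
  simp only [mul_apply_eq_comp, convL2_toL2, conv_translate_left,
    conv_translate_right]
  congr 1
  ext z
  simp only [translate_apply]
  rw [mul_assoc, mul_left_comm]

theorem inner_conv (φ ψ η : C(G, ℂ)) :
    inner ℂ (toL2 (conv (reflect φ) ψ)) (toL2 η) = inner ℂ (toL2 ψ) (toL2 (conv φ η)) := by
  simp only [inner_toL2, conv_apply, ← integral_conj, ← integral_mul_const, ← integral_const_mul]
  rw [integral_swap]
  · congr 1 with x
    congr 1 with y
    simp only [reflect_apply, map_mul, RingHomCompTriple.comp_apply, RingHom.id_apply, mul_inv_rev,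
      inv_inv]
    ring
  · simp only [Function.uncurry_def]
    fun_prop

theorem star_convL2 (φ : C(G, ℂ)) : star (convL2 φ) = convL2 (reflect φ) := by
  symm
  rw [ContinuousLinearMap.star_eq_adjoint, ContinuousLinearMap.eq_adjoint_iff]
  intro u v
  refine denseRange_toL2.induction_on (p := fun u => inner ℂ (convL2 (reflect φ) u) v =
    inner ℂ u (convL2 φ v)) u (isClosed_eq (by fun_prop) (by fun_prop)) fun ψ => ?_
  refine denseRange_toL2.induction_on (p := fun v => inner ℂ (convL2 (reflect φ) (toL2 ψ)) v =
    inner ℂ (toL2 ψ) (convL2 φ v)) v (isClosed_eq (by fun_prop) (by fun_prop)) fun η => ?_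
  rw [convL2_toL2, convL2_toL2, inner_conv]

/-- Convolving φ with the conjugate of its own slice at x and evaluating at x gives the squared L²
norm of that slice, so a vanishing operator forces φ = 0. -/
theorem convL2_ne_zero {φ : C(G, ℂ)} (hφ : φ ≠ 0) : convL2 φ ≠ 0 := by
  intro h
  apply hφ
  ext x
  have h1 : toL2 (conv φ (star (slice φ x))) = 0 := by rw [← convL2_toL2, h]; rfl
  have h2 : conv φ (star (slice φ x)) = 0 :=
    ContinuousMap.toLp_injective (haarProb G) (by rw [h1, map_zero])
  have h3 : toL2 (star (slice φ x)) = 0 := by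
    rw [← inner_self_eq_zero (𝕜 := ℂ), inner_toL2]
    have := congrArg (fun η : C(G, ℂ) => η x) h2
    simpa [conv_apply] using this
  have h4 : star (slice φ x) = 0 :=
    ContinuousMap.toLp_injective (haarProb G) (by rw [h3, map_zero])
  simpa using congrArg (fun η : C(G, ℂ) => η 1) h4

end Convolution

/-! ### Gelfand theory for commuting self-adjoint families. -/

section Gelfand

/-- A commuting self-adjoint subset of a C⋆-algebra generates a commutative algebra, whose Gelfand
transform detects each non-zero element of the subset. -/
theorem exists_algHom_ne_zero {B : Type*} [CStarAlgebra B] (S : Set B)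
    (hcomm : ∀ a ∈ S, ∀ b ∈ S, a * b = b * a) (hstar : ∀ a ∈ S, star a ∈ S) {a : B} (ha : a ∈ S)
    (ha0 : a ≠ 0) :
    ∃ (A : StarSubalgebra ℂ B) (χ : A →ₐ[ℂ] ℂ) (hS : S ⊆ A), Continuous χ ∧ χ ⟨a, hS ha⟩ ≠ 0 := by
  -- The bicommutant is automatically closed. As S lies in its own commutant, S'' ⊆ S', so any two
  -- elements of S'' commute.
  let A : StarSubalgebra ℂ B :=
    StarSubalgebra.centralizer ℂ (StarSubalgebra.centralizer ℂ S : Set B)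
  have hSC : S ⊆ StarSubalgebra.centralizer ℂ S := fun b hb => by
    rw [SetLike.mem_coe, StarSubalgebra.mem_centralizer_iff]
    exact fun c hc => ⟨hcomm c hc b hb, hcomm _ (hstar c hc) b hb⟩
  have hAC : (A : Set B) ⊆ StarSubalgebra.centralizer ℂ S := fun b hb => by
    rw [SetLike.mem_coe, StarSubalgebra.mem_centralizer_iff] at hb ⊢
    exact fun c hc => hb c (hSC hc)
  have hS : S ⊆ A := fun b hb => by
    rw [SetLike.mem_coe, StarSubalgebra.mem_centralizer_iff]
    intro c hc
    rw [SetLike.mem_coe, StarSubalgebra.mem_centralizer_iff] at hc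
    refine ⟨(hc b hb).1.symm, ?_⟩
    have := congrArg star (hc b hb).2
    simpa using this
  have hclosed : IsClosed (A : Set B) := Set.isClosed_centralizer _
  let _ : CommCStarAlgebra A :=
    { StarSubalgebra.cstarAlgebra A (h_closed := hclosed) with
      mul_comm := fun x y => Subtype.ext
        ((StarSubalgebra.mem_centralizer_iff ℂ).1 y.2 x (hAC x.2)).1 }
  have hne : WeakDual.gelfandTransform ℂ A ⟨a, hS ha⟩ ≠ 0 := by
    intro h
    apply ha0
    have := (gelfandTransform_isometry A).injective (h.trans (map_zero _).symm)
    exact congrArg Subtype.val this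
  obtain ⟨χ, hχ⟩ : ∃ χ, WeakDual.gelfandTransform ℂ A ⟨a, hS ha⟩ χ ≠ 0 := by
    by_contra! h
    exact hne (ContinuousMap.ext h)
  exact ⟨A, WeakDual.CharacterSpace.toAlgHom χ, hS, map_continuous χ, hχ⟩

end Gelfand

/-! ### Existence of enough characters and density of trigonometric polynomials. -/

section Characters

variable {G : Type*} [CommGroup G] [TopologicalSpace G] [IsTopologicalGroup G] [CompactSpace G]

-- All powers of x stay in the compact group, where h is bounded; hence ‖h x‖ ≤ 1, and the same
-- bound for x⁻¹ forces equality.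
omit [IsTopologicalGroup G] in
theorem norm_monoidHom_eq_one (h : G →* ℂ) (hc : Continuous h) (x : G) : ‖h x‖ = 1 := by
  obtain ⟨C, hC⟩ := isCompact_univ.exists_bound_of_continuousOn hc.continuousOn
  have hle : ∀ x, ‖h x‖ ≤ 1 := fun x => by
    by_contra! hx
    obtain ⟨n, hn⟩ := pow_unbounded_of_one_lt C hx
    have := hC (x ^ n) trivial
    rw [map_pow, norm_pow] at this
    linarith
  have hmul : ‖h x‖ * ‖h x⁻¹‖ = 1 := by rw [← norm_mul, ← map_mul, mul_inv_cancel, map_one, norm_one]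
  nlinarith [hle x, hle x⁻¹, norm_nonneg (h x), norm_nonneg (h x⁻¹)]

/-- A continuous homomorphism from a compact group to `ℂ` takes values in the unit circle. -/
def circleHom (h : G →* ℂ) (hc : Continuous h) : G →ₜ* Circle where
  toFun x := ⟨h x, mem_sphere_zero_iff_norm.2 (norm_monoidHom_eq_one h hc x)⟩
  map_one' := Circle.ext (map_one h)
  map_mul' x y := Circle.ext (map_mul h x y)
  continuous_toFun := hc.subtype_mk _

variable [T2Space G]

/-- The characters of a compact abelian group separate the points. -/
theorem exists_character_ne_one {a : G} (ha : a ≠ 1) : ∃ h : G →ₜ* Circle, h a ≠ 1 := by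
  borelize G
  obtain ⟨φ, hφ⟩ : ∃ φ : C(G, ℂ), φ a ≠ φ 1 := by
    obtain ⟨f, h0, h1, -⟩ := exists_continuous_zero_one_of_isClosed (isClosed_singleton (x := a))
      (isClosed_singleton (x := (1 : G))) (by simpa using ha)
    refine ⟨⟨fun x => (f x : ℂ), by fun_prop⟩, ?_⟩
    have h0 : f a = 0 := h0 rfl
    have h1 : f 1 = 1 := h1 rfl
    simp [h0, h1]
  -- Choosing χ not to kill the operator of `translate φ a - φ` ensures that the character obtained
  -- below by normalizing differs from 1 at a.
  obtain ⟨A, χ, hS, hχ, hne⟩ := exists_algHom_ne_zero (Set.range (convL2 (G := G)))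
    (by rintro _ ⟨φ, rfl⟩ _ ⟨ψ, rfl⟩; exact commute_convL2 φ ψ)
    (by rintro _ ⟨φ, rfl⟩; exact ⟨_, (star_convL2 φ).symm⟩)
    (a := convL2 (translate φ a - φ)) ⟨_, rfl⟩
    (convL2_ne_zero fun h => hφ <| by simpa [sub_eq_zero] using congrArg (fun ψ : C(G, ℂ) => ψ 1) h)
  let T : C(G, ℂ) → A := fun ψ => ⟨convL2 ψ, hS ⟨ψ, rfl⟩⟩
  have hT : Continuous T := continuous_convL2.subtype_mk _
  have hTmul : ∀ x y, χ (T (translate φ x)) * χ (T (translate φ y)) =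
      χ (T (translate φ (x * y))) * χ (T φ) := fun x y => by
    rw [← map_mul, ← map_mul]
    exact congrArg χ (Subtype.ext (convL2_translate_mul φ φ x y))
  have hne' : χ (T (translate φ a)) ≠ χ (T φ) := fun h => hne <| by
    have : (⟨convL2 (translate φ a - φ), hS ⟨_, rfl⟩⟩ : A) = T (translate φ a) - T φ :=
      Subtype.ext (convL2_sub _ _)
    rw [this, map_sub, h, sub_self]
  -- If the denominator vanished, `hTmul a a` would make the square of χ at the translate by a
  -- vanish, so both values compared in `hne'` would be 0.
  have hφ0 : χ (T φ) ≠ 0 := fun h => hne' <| by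
    have := hTmul a a
    rw [h, mul_zero, mul_self_eq_zero] at this
    rw [h, this]
  have htr : translate φ 1 = φ := by ext x; simp
  let h : G →* ℂ :=
    { toFun := fun x => χ (T (translate φ x)) / χ (T φ)
      map_one' := by rw [htr, div_self hφ0]
      map_mul' := fun x y => by
        rw [div_mul_div_comm, hTmul, mul_div_mul_right _ _ hφ0] }
  have hc : Continuous h :=
    (hχ.comp (hT.comp (translate φ).continuous)).div_const _
  refine ⟨circleHom h hc, fun h1 => hne' ?_⟩
  have : χ (T (translate φ a)) / χ (T φ) = 1 := congrArg (fun z : Circle => (z : ℂ)) h1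
  exact (div_eq_one_iff_eq hφ0).1 this

/-- A continuous character as a continuous complex valued function. -/
def charMap : (G →ₜ* Circle) →* C(G, ℂ) where
  toFun h := ⟨fun x => (h x : ℂ), by fun_prop⟩
  map_one' := rfl
  map_mul' _ _ := rfl

omit [IsTopologicalGroup G] [CompactSpace G] [T2Space G] in
@[simp] theorem charMap_apply [IsTopologicalGroup G] (h : G →ₜ* Circle) (x : G) :
    charMap h x = (h x : ℂ) := rfl

/-- The trigonometric polynomials are dense in the continuous functions. -/
theorem dense_span_characters :
    (Submodule.span ℂ (Set.range (charMap (G := G)))).topologicalClosure = ⊤ := by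
  have hstar : ∀ h : G →ₜ* Circle, star (charMap h) = charMap h⁻¹ := fun h => by
    ext x
    exact (Circle.coe_inv_eq_conj (h x)).symm
  let A : StarSubalgebra ℂ C(G, ℂ) :=
    { Algebra.adjoin ℂ (Set.range (charMap (G := G))) with
      star_mem' := fun {φ} hφ => by
        change φ ∈ Algebra.adjoin ℂ _ at hφ
        change star φ ∈ Algebra.adjoin ℂ _
        induction hφ using Algebra.adjoin_induction with
        | mem φ hφ =>
          obtain ⟨h, rfl⟩ := hφ
          rw [hstar]
          exact Algebra.subset_adjoin ⟨_, rfl⟩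
        | algebraMap c =>
          rw [← algebraMap_star_comm]
          exact Subalgebra.algebraMap_mem _ _
        | add φ ψ _ _ hφ hψ => rw [star_add]; exact add_mem hφ hψ
        | mul φ ψ _ _ hφ hψ => rw [star_mul]; exact mul_mem hψ hφ }
  have hA : A.SeparatesPoints := by
    intro x y hxy
    obtain ⟨h, hh⟩ := exists_character_ne_one (a := x * y⁻¹) (by rwa [Ne, mul_inv_eq_one])
    refine ⟨_, ⟨charMap h, Algebra.subset_adjoin ⟨h, rfl⟩, rfl⟩, fun he => hh ?_⟩
    rw [map_mul, map_inv, mul_inv_eq_one]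
    exact Circle.ext he
  have htop := ContinuousMap.starSubalgebra_topologicalClosure_eq_top_of_separatesPoints A hA
  have hspan : Subalgebra.toSubmodule (Algebra.adjoin ℂ (Set.range (charMap (G := G)))) =
      Submodule.span ℂ (Set.range (charMap (G := G))) := by
    rw [Algebra.adjoin_eq_span, ← MonoidHom.coe_mrange, Submonoid.closure_eq]
  rw [← hspan]
  exact SetLike.coe_injective (congrArg SetLike.coe htop : _)

end Characters

/-! ### Uniqueness of Fourier coefficients in L¹. -/

section Uniqueness

/-- An integrable function on a compact space that annihilates the continuous functions vanishes
almost everywhere. -/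
theorem ae_eq_zero_of_forall_integral_mul_continuousMap {X : Type*} [TopologicalSpace X]
    [CompactSpace X] [T2Space X] [MeasurableSpace X] [BorelSpace X] {μ : Measure X} [μ.Regular]
    [IsFiniteMeasure μ] {g : X → ℂ} (hg : Integrable g μ)
    (h : ∀ φ : C(X, ℂ), ∫ x, g x * φ x ∂μ = 0) : g =ᵐ[μ] 0 := by
  refine ae_eq_zero_of_forall_setIntegral_isClosed_eq_zero hg fun K hK => ?_
  have hU : ∀ n : ℕ, ∃ U ⊇ K, IsOpen U ∧ μ U ≤ μ K + (n + 1 : ENNReal)⁻¹ := fun n => by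
    obtain ⟨U, hKU, hU, hlt⟩ := K.exists_isOpen_lt_add (measure_ne_top μ K)
      (ENNReal.inv_ne_zero.2 (by finiteness : (n + 1 : ENNReal) ≠ ⊤))
    exact ⟨U, hKU, hU, hlt.le⟩
  choose U hKU hUo hUμ using hU
  -- Finite intersections make the neighbourhoods decreasing: a point outside one `U m` is outside
  -- every `V n` with n ≥ m, so the Urysohn functions tend to the indicator of K off the null set
  -- `(⋂ n, U n) \ K`.
  let V : ℕ → Set X := fun n => ⋂ k ∈ Finset.range (n + 1), U k
  have hVo : ∀ n, IsOpen (V n) := fun n => isOpen_biInter_finset fun k _ => hUo k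
  have hKV : ∀ n, K ⊆ V n := fun n => Set.subset_iInter₂ fun k _ => hKU k
  have hf : ∀ n, ∃ f : C(X, ℝ), Set.EqOn f 0 (V n)ᶜ ∧ Set.EqOn f 1 K ∧ ∀ x, f x ∈ Set.Icc 0 1 :=
    fun n => exists_continuous_zero_one_of_isClosed (hVo n).isClosed_compl hK
      (Set.disjoint_left.2 fun x hx hxK => hx (hKV n hxK))
  choose f hf0 hf1 hf01 using hf
  have hnull : μ ((⋂ n, U n) \ K) = 0 := by
    have hle : μ (⋂ n, U n) ≤ μ K := by
      refine ge_of_tendsto' (f := fun n : ℕ => μ K + (n + 1 : ENNReal)⁻¹) (x := atTop) ?_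
        fun n => (measure_mono (Set.iInter_subset _ n)).trans (hUμ n)
      have : Tendsto (fun n : ℕ => ((n + 1 : ℕ) : ENNReal)⁻¹) atTop (𝓝 0) :=
        ENNReal.tendsto_inv_nat_nhds_zero.comp (tendsto_add_atTop_nat 1)
      simpa using (tendsto_const_nhds (x := μ K)).add this
    rw [measure_sdiff (Set.subset_iInter hKU) hK.measurableSet.nullMeasurableSet
      (measure_ne_top μ K), tsub_eq_zero_of_le hle]
  have hlim : Tendsto (fun n => ∫ x, g x * (f n x : ℂ) ∂μ) atTop
      (𝓝 (∫ x, K.indicator g x ∂μ)) := by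
    refine tendsto_integral_of_dominated_convergence (fun x => ‖g x‖) (fun n => ?_) hg.norm
      (fun n => .of_forall fun x => ?_) ?_
    · exact hg.aestronglyMeasurable.mul
        (Complex.continuous_ofReal.comp (f n).continuous).aestronglyMeasurable
    · rw [norm_mul, Complex.norm_real, Real.norm_of_nonneg (hf01 n x).1]
      exact mul_le_of_le_one_right (norm_nonneg _) (hf01 n x).2
    · filter_upwards [measure_eq_zero_iff_ae_notMem.1 hnull] with x hx
      by_cases hxK : x ∈ K
      · rw [Set.indicator_of_mem hxK]
        refine tendsto_const_nhds.congr fun n => ?_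
        simp [hf1 n hxK]
      · rw [Set.indicator_of_notMem hxK]
        obtain ⟨m, hm⟩ : ∃ m, x ∉ U m := by simpa [hxK] using hx
        refine tendsto_const_nhds.congr' ?_
        filter_upwards [eventually_ge_atTop m] with n hn
        have : x ∉ V n := fun hxV => hm (Set.mem_iInter₂.1 hxV m (by simp; omega))
        simp [hf0 n this]
  rw [← integral_indicator hK.measurableSet]
  refine tendsto_nhds_unique hlim (tendsto_const_nhds.congr fun n => ?_)
  exact (h ⟨fun x => (f n x : ℂ), by fun_prop⟩).symm

variable {G : Type*} [CommGroup G] [TopologicalSpace G] [IsTopologicalGroup G] [CompactSpace G]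
  [T2Space G] [MeasurableSpace G] [BorelSpace G]

/-- An integrable function on a compact abelian group is determined by its Fourier coefficients. -/
theorem ae_eq_zero_of_fourierCoeff {g : G → ℂ} (hg : Integrable g (haarProb G))
    (h : ∀ χ : G →ₜ* Circle, fourierCoeff g χ = 0) : g =ᵐ[haarProb G] 0 := by
  refine ae_eq_zero_of_forall_integral_mul_continuousMap hg fun φ => ?_
  have hint : ∀ φ : C(G, ℂ), Integrable (fun x => g x * φ x) (haarProb G) := fun φ =>
    hg.mul_bdd φ.continuous.aestronglyMeasurable (.of_forall φ.norm_coe_le_norm)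
  let L : C(G, ℂ) →L[ℂ] ℂ := LinearMap.mkContinuous
    { toFun := fun φ => ∫ x, g x * φ x ∂(haarProb G)
      map_add' := fun φ ψ => by
        simp only [ContinuousMap.add_apply, mul_add]
        exact integral_add (hint φ) (hint ψ)
      map_smul' := fun c φ => by
        simp only [ContinuousMap.smul_apply, smul_eq_mul, RingHom.id_apply, ← integral_const_mul]
        congr 1 with x
        ring }
    (∫ x, ‖g x‖ ∂(haarProb G)) (fun φ => by
      rw [← integral_mul_const]
      refine norm_integral_le_of_norm_le (hg.norm.mul_const _) (.of_forall fun x => ?_)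
      rw [norm_mul]
      gcongr
      exact φ.norm_coe_le_norm x)
  have hspan : Submodule.span ℂ (Set.range (charMap (G := G))) ≤ L.ker := by
    rw [Submodule.span_le]
    rintro _ ⟨χ, rfl⟩
    -- The Fourier coefficient conjugates its character, so integration against χ is the coefficient
    -- at χ⁻¹.
    have := h χ⁻¹
    rw [fourierCoeff] at this
    refine (integral_congr_ae (.of_forall fun x => ?_)).trans this
    have : starRingEnd ℂ ((χ⁻¹ x : Circle) : ℂ) = (χ x : ℂ) := by
      rw [← Circle.coe_inv_eq_conj]
      exact congrArg _ (inv_inv (χ x))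
    simp [this]
  have hker : (⊤ : Submodule ℂ C(G, ℂ)) ≤ L.ker := by
    rw [← dense_span_characters]
    exact Submodule.topologicalClosure_minimal _ hspan L.isClosed_ker
  exact hker (Submodule.mem_top (x := φ))

end Uniqueness

/-! ### The dominating weight and explicit Fourier transforms on the line. -/

section FourierPairs

open Set

theorem integrable_comp_abs {F : ℝ → ℝ} (hF : IntegrableOn F (Ioi 0)) :
    Integrable (fun x => F |x|) := by
  have h1 : IntegrableOn (fun x => F |x|) (Ioi 0) :=
    hF.congr_fun (fun x hx => by rw [abs_of_pos hx]) measurableSet_Ioi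
  have h2 : IntegrableOn (fun x => F |x|) (Iio 0) := by
    have : IntegrableOn (fun x => F |-x|) (Iio 0) :=
      IntegrableOn.comp_neg_Iio (f := fun x => F |x|) (c := 0) (by simpa using h1)
    simpa using this
  rw [← integrableOn_univ, ← Iic_union_Ioi (a := (0 : ℝ))]
  exact ((integrableOn_Iic_iff_integrableOn_Iio (by simp)).2 h2).union h1

/-- An integrable weight on the line that decays only slightly faster than `1 / |t|`. -/
def weight (t : ℝ) : ℝ := 1 / ((1 + |t|) * (1 + Real.log (1 + |t|)) ^ 2)

theorem one_le_one_add_log {x : ℝ} (hx : 0 ≤ x) : 1 ≤ 1 + Real.log (1 + x) := by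
  have := Real.log_nonneg (by linarith : 1 ≤ 1 + x)
  linarith

theorem one_add_log_sq_le {x : ℝ} (hx : 0 ≤ x) : (1 + Real.log (1 + x)) ^ 2 ≤ 4 * (1 + x) := by
  have hs : 0 < √(1 + x) := Real.sqrt_pos.2 (by linarith)
  have h1 : Real.log (1 + x) ≤ 2 * (√(1 + x) - 1) := by
    have := Real.log_le_sub_one_of_pos hs
    rw [Real.log_sqrt (by linarith)] at this
    linarith
  calc (1 + Real.log (1 + x)) ^ 2 ≤ (2 * √(1 + x)) ^ 2 :=
        pow_le_pow_left₀ (by linarith [one_le_one_add_log hx]) (by linarith) 2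
    _ = 4 * (1 + x) := by rw [mul_pow, Real.sq_sqrt (by linarith)]; norm_num

theorem weight_pos (t : ℝ) : 0 < weight t := by
  have := one_le_one_add_log (abs_nonneg t)
  unfold weight
  positivity

theorem measurable_weight : Measurable weight := by unfold weight; fun_prop

/-- On the positive half-line the weight is the derivative of -1/(1 + log(1 + x)), which is bounded;
the square on the logarithm is there for this. -/
theorem integrable_weight : Integrable weight := by
  refine integrable_comp_abs (F := fun x => 1 / ((1 + x) * (1 + Real.log (1 + x)) ^ 2)) ?_
  have hpos : ∀ x : ℝ, 0 ≤ x → 0 < 1 + Real.log (1 + x) := fun x hx => by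
    linarith [one_le_one_add_log hx]
  refine integrableOn_Ioi_deriv_of_nonneg' (g := fun x => -(1 + Real.log (1 + x))⁻¹) (l := -0)
    (fun x hx => ?_) (fun x hx => ?_) ?_
  · have hx : 0 ≤ x := hx
    have h1 : HasDerivAt (fun x : ℝ => 1 + Real.log (1 + x)) (1 / (1 + x)) x :=
      (((hasDerivAt_id x).const_add 1).log (by simp; linarith)).const_add 1
    refine (h1.inv (hpos x hx).ne').neg.congr_deriv ?_
    rw [neg_div, neg_neg, div_div]
  · have hx : 0 < x := hx
    have := hpos x hx.le
    positivity
  · exact (tendsto_inv_atTop_zero.comp (tendsto_atTop_add_const_left _ _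
      (Real.tendsto_log_atTop.comp (tendsto_atTop_add_const_left _ _ tendsto_id)))).neg

theorem abs_poisson_le {u : ℝ} (hu : 0 < u) (t : ℝ) :
    ‖poisson u t‖ ≤ 8 * (u + 1 / u) * weight t := by
  have hl := one_le_one_add_log (abs_nonneg t)
  have hden : 0 < u ^ 2 + t ^ 2 := by positivity
  have h1 : poisson u t ≤ u / (u ^ 2 + t ^ 2) := by
    unfold poisson
    refine mul_le_of_le_one_left (by positivity) ?_
    rw [div_le_one Real.pi_pos]
    linarith [Real.pi_gt_three]
  rw [Real.norm_of_nonneg (by unfold poisson; positivity)]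
  refine h1.trans ?_
  unfold weight
  rw [mul_one_div, div_le_div_iff₀ hden (by positivity)]
  have h2 : (1 + |t|) * (1 + Real.log (1 + |t|)) ^ 2 ≤ 8 * (1 + t ^ 2) := by
    calc _ ≤ (1 + |t|) * (4 * (1 + |t|)) := by gcongr; exact one_add_log_sq_le (abs_nonneg t)
      _ ≤ 8 * (1 + t ^ 2) := by nlinarith [sq_nonneg (1 - |t|), sq_abs t]
  have h3 : u * (1 + t ^ 2) ≤ (u + 1 / u) * (u ^ 2 + t ^ 2) := by
    have : (u + 1 / u) * (u ^ 2 + t ^ 2) = u * (1 + t ^ 2) + (u ^ 3 + t ^ 2 / u) := by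
      field_simp
      ring
    rw [this]
    have : 0 ≤ u ^ 3 + t ^ 2 / u := by positivity
    linarith
  calc _ ≤ u * (8 * (1 + t ^ 2)) := by gcongr
    _ = 8 * (u * (1 + t ^ 2)) := by ring
    _ ≤ 8 * ((u + 1 / u) * (u ^ 2 + t ^ 2)) := by gcongr
    _ = _ := by ring

theorem integral_abs_mul_cexp {F : ℝ → ℝ} (hF : IntegrableOn F (Ioi 0)) (t : ℝ) :
    ∫ x : ℝ, (F |x| : ℂ) * Complex.exp (Complex.I * x * t) =
      (∫ x in Ioi (0 : ℝ), (F x : ℂ) * Complex.exp (x * (Complex.I * t))) +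
      ∫ x in Ioi (0 : ℝ), (F x : ℂ) * Complex.exp (x * -(Complex.I * t)) := by
  have hint : Integrable fun x : ℝ => (F |x| : ℂ) * Complex.exp (Complex.I * x * t) := by
    refine (integrable_comp_abs hF).ofReal.mul_bdd (c := 1)
      (Continuous.aestronglyMeasurable (by fun_prop)) (.of_forall fun x => ?_)
    rw [show Complex.I * x * t = ((x * t : ℝ) : ℂ) * Complex.I by push_cast; ring,
      Complex.norm_exp_ofReal_mul_I]
  rw [← intervalIntegral.integral_Iic_add_Ioi (b := 0) hint.integrableOn hint.integrableOn,
    add_comm]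
  congr 1
  · refine setIntegral_congr_fun measurableSet_Ioi fun x hx => ?_
    simp only [abs_of_pos (mem_Ioi.1 hx)]
    congr 2
    ring
  · rw [← neg_zero, ← integral_comp_neg_Ioi, neg_zero]
    refine setIntegral_congr_fun measurableSet_Ioi fun x hx => ?_
    simp only [abs_neg, abs_of_pos (mem_Ioi.1 hx)]
    congr 2
    push_cast
    ring

open scoped FourierTransform in
/-- Fourier inversion, without normalization of the frequencies. -/
theorem integral_mul_cexp_of_integral_mul_cexp {φ K : ℝ → ℂ} (hφ : Continuous φ)
    (hφi : Integrable φ) (hK : Integrable K)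
    (h : ∀ t : ℝ, t ≠ 0 → ∫ x : ℝ, φ x * Complex.exp (Complex.I * x * t) = 2 * Real.pi * K t)
    (x : ℝ) : ∫ t : ℝ, K t * Complex.exp (-Complex.I * x * t) = φ x := by
  have hpi : (-(2 * Real.pi)) ≠ 0 := by simp [Real.pi_ne_zero]
  -- The value at 0 is immaterial. Integrability of K thus passes to the transform of φ, which is
  -- what inversion at every point requires.
  have hF : 𝓕 φ =ᵐ[volume] fun w => 2 * Real.pi * K (-(2 * Real.pi) * w) := by
    filter_upwards [compl_mem_ae_iff.2 (measure_singleton (0 : ℝ))] with w hw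
    rw [← h _ (mul_ne_zero hpi hw), Real.fourier_real_eq_integral_exp_smul]
    congr 1 with v
    rw [smul_eq_mul, mul_comm]
    congr 2
    push_cast
    ring
  have hFi : Integrable (𝓕 φ) :=
    (((hK.comp_mul_left' hpi).const_mul _)).congr hF.symm
  rw [← congrFun (hφ.fourierInv_fourier_eq hφi hFi) x, Real.fourierInv_eq']
  have hscale := Measure.integral_comp_mul_left
    (fun t => K t * Complex.exp (-Complex.I * x * t)) (-(2 * Real.pi))
  rw [abs_inv, abs_neg, abs_of_pos Real.two_pi_pos, eq_inv_smul_iff₀ Real.two_pi_pos.ne'] at hscale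
  rw [← hscale, ← integral_smul]
  refine integral_congr_ae (hF.mono fun w hw => ?_)
  simp only [hw, smul_eq_mul, Complex.real_smul]
  rw [mul_comm (Complex.exp _), ← mul_assoc]
  push_cast
  congr 2
  simp
  ring

/-- The transform of e^{-u|x|} is elementary on each half-line and equals 2π times the Poisson
kernel; inversion gives the converse. -/
theorem poisson_fourier {u : ℝ} (hu : 0 < u) (x : ℝ) :
    ∫ t : ℝ, (poisson u t : ℂ) * Complex.exp (-Complex.I * x * t) = Real.exp (-u * |x|) := by
  have hexp : IntegrableOn (fun x => Real.exp (-u * x)) (Ioi 0) :=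
    integrableOn_exp_mul_Ioi (by simpa) 0
  have hP : Integrable fun t => (poisson u t : ℂ) := by
    refine ((integrable_weight.const_mul (8 * (u + 1 / u))).mono' ?_
      (.of_forall (abs_poisson_le hu))).ofReal
    exact (by unfold poisson; fun_prop : Measurable (poisson u)).aestronglyMeasurable
  refine integral_mul_cexp_of_integral_mul_cexp (φ := fun x => (Real.exp (-u * |x|) : ℂ))
    (by fun_prop) (integrable_comp_abs hexp).ofReal hP (fun t ht => ?_) x
  rw [integral_abs_mul_cexp hexp]
  have key : ∀ c : ℂ, c.re = 0 → ∫ x in Ioi (0 : ℝ), (Real.exp (-u * x) : ℂ) * Complex.exp (x * c) =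
      1 / (u - c) := fun c hc => by
    have h1 : (-u + c : ℂ).re < 0 := by simp [hc, hu]
    have := integral_exp_mul_complex_Ioi h1 0
    simp only [Complex.ofReal_zero, mul_zero, Complex.exp_zero] at this
    rw [show 1 / (u - c) = -1 / (-u + c) by rw [← neg_div_neg_eq]; ring_nf, ← this]
    congr 1 with x
    push_cast
    rw [← Complex.exp_add]
    ring_nf
  rw [key _ (by simp), key _ (by simp), poisson]
  have h1 : (u : ℂ) - Complex.I * t ≠ 0 := fun h => hu.ne' (by simpa using congrArg Complex.re h)
  have h2 : (u : ℂ) - -(Complex.I * t) ≠ 0 :=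
    fun h => hu.ne' (by simpa using congrArg Complex.re h)
  have h3 : (u : ℂ) ^ 2 + t ^ 2 ≠ 0 := by
    have : 0 < u ^ 2 + t ^ 2 := by positivity
    exact_mod_cast this.ne'
  have hpi : (Real.pi : ℂ) ≠ 0 := by exact_mod_cast Real.pi_ne_zero
  push_cast
  field_simp
  ring_nf
  simp

/-- The function `max 0 (b - |x|)`. -/
def triangle (b x : ℝ) : ℝ := max 0 (b - |x|)

theorem integral_triangle {b : ℝ} (hb : 0 ≤ b) {t : ℝ} (ht : t ≠ 0) :
    ∫ x : ℝ, (triangle b x : ℂ) * Complex.exp (Complex.I * x * t) =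
      2 * (1 - Real.cos (b * t)) / t ^ 2 := by
  have hint : IntegrableOn (fun x => max 0 (b - x)) (Ioi 0) := by
    refine IntegrableOn.of_forall_sdiff_eq_zero (s := Ioc 0 b)
      (Continuous.integrableOn_Ioc (by fun_prop)) measurableSet_Ioi fun x hx => ?_
    exact max_eq_left (sub_nonpos.2 (le_of_not_gt fun hlt => hx.2 ⟨hx.1, hlt.le⟩))
  have key : ∀ c : ℂ, c ≠ 0 → ∫ x in Ioi (0 : ℝ), ((max 0 (b - x) : ℝ) : ℂ) * Complex.exp (x * c) =
      (Complex.exp (b * c) - 1) / c ^ 2 - b / c := fun c hc => by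
    have hsub : ∫ x in Ioi (0 : ℝ), ((max 0 (b - x) : ℝ) : ℂ) * Complex.exp (x * c) =
        ∫ x in (0 : ℝ)..b, ((b : ℂ) - x) * Complex.exp (x * c) := by
      rw [intervalIntegral.integral_of_le hb]
      rw [setIntegral_eq_of_subset_of_forall_sdiff_eq_zero measurableSet_Ioi
        (Ioc_subset_Ioi_self : Ioc 0 b ⊆ Ioi 0)]
      · refine setIntegral_congr_fun measurableSet_Ioc fun x hx => ?_
        simp only [max_eq_right (sub_nonneg.2 hx.2)]
        push_cast
        rfl
      · rintro x ⟨hx0, hx⟩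
        have : b ≤ x := by
          by_contra! hlt
          exact hx ⟨hx0, hlt.le⟩
        simp [max_eq_left (sub_nonpos.2 this)]
    rw [hsub]
    have hd : ∀ x : ℝ, HasDerivAt (fun x : ℝ => ((b : ℂ) - x) * Complex.exp (x * c) / c +
        Complex.exp (x * c) / c ^ 2) (((b : ℂ) - x) * Complex.exp (x * c)) x := fun x => by
      have h1 : HasDerivAt (fun x : ℝ => Complex.exp (x * c)) (Complex.exp (x * c) * (1 * c)) x :=
        (Complex.ofRealCLM.hasDerivAt (x := x).mul_const c).cexp
      have h2 : HasDerivAt (fun x : ℝ => (b : ℂ) - x) (-1) x :=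
        (Complex.ofRealCLM.hasDerivAt (x := x)).const_sub (b : ℂ)
      refine (((h2.mul h1).div_const c).add (h1.div_const (c ^ 2))).congr_deriv ?_
      field_simp
      ring
    rw [intervalIntegral.integral_eq_sub_of_hasDerivAt (fun x _ => hd x)
      (Continuous.intervalIntegrable (by fun_prop) _ _)]
    simp
    ring
  have hI : Complex.I * t ≠ 0 := mul_ne_zero Complex.I_ne_zero (by exact_mod_cast ht)
  have h := integral_abs_mul_cexp hint t
  rw [key _ hI, key _ (neg_ne_zero.2 hI)] at h
  refine h.trans ?_
  have ht' : (t : ℂ) ≠ 0 := by exact_mod_cast ht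
  rw [show (b : ℂ) * (Complex.I * t) = (b * t : ℂ) * Complex.I by ring,
    show (b : ℂ) * -(Complex.I * t) = -(b * t : ℂ) * Complex.I by ring, Complex.ofReal_cos,
    Complex.cos, neg_sq, mul_pow, Complex.I_sq]
  push_cast
  field_simp
  ring

end FourierPairs

/-! ### Kernels that produce partial sums, and their bound under Landau's condition. -/

section PartialSumKernel

/-- The kernel whose Fourier transform is the trapezoid that equals `1` on `[-a, a]` and vanishes
outside `[-(a + h), a + h]`. -/
def trapezoidKernel (a h t : ℝ) : ℝ :=
  (Real.cos (a * t) - Real.cos ((a + h) * t)) / (Real.pi * h * t ^ 2)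

/-- The numerator is bounded by 2, by h|t| and by (a + h/2)ht², sharp for large, intermediate and
small t respectively. Between |t| ~ 1 and |t| ~ 1/h the kernel decays only like 1/|t|, so comparison
with the weight there costs a squared logarithm of 1/h rather than a power of it. -/
theorem abs_trapezoidKernel_le {a h : ℝ} (ha : 0 ≤ a) (hh : 0 < h) (hh1 : h ≤ 1) (t : ℝ) :
    ‖trapezoidKernel a h t‖ ≤ 4 * (a + 2) * (1 + Real.log (1 + 1 / h)) ^ 2 * weight t := by
  rcases eq_or_ne t 0 with rfl | ht
  · simp only [trapezoidKernel, mul_zero, sub_self, zero_div, norm_zero]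
    exact mul_nonneg (by positivity) (weight_pos 0).le
  have ht2 : 0 < t ^ 2 := by positivity
  have hat : 0 < |t| := abs_pos.2 ht
  set D := |Real.cos (a * t) - Real.cos ((a + h) * t)| with hD
  have hprod : D = 2 * |Real.sin ((2 * a + h) * t / 2)| * |Real.sin (h * t / 2)| := by
    rw [hD, Real.cos_sub_cos, show (a * t - (a + h) * t) / 2 = -(h * t / 2) by ring, Real.sin_neg,
      abs_mul, abs_mul, abs_neg, abs_neg, abs_two]
    congr 4
    ring
  have hs1 : |Real.sin ((2 * a + h) * t / 2)| ≤ (2 * a + h) * |t| / 2 := by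
    refine Real.abs_sin_le_abs.trans_eq ?_
    rw [abs_div, abs_mul, abs_two, abs_of_pos (by positivity : 0 < 2 * a + h)]
  have hs2 : |Real.sin (h * t / 2)| ≤ h * |t| / 2 := by
    refine Real.abs_sin_le_abs.trans_eq ?_
    rw [abs_div, abs_mul, abs_two, abs_of_pos hh]
  have hs3 := Real.abs_sin_le_one ((2 * a + h) * t / 2)
  have hs4 := Real.abs_sin_le_one (h * t / 2)
  have hD0 : D ≤ 2 := by
    rw [hprod]
    nlinarith [abs_nonneg (Real.sin ((2 * a + h) * t / 2)), abs_nonneg (Real.sin (h * t / 2))]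
  have hD1 : D ≤ h * |t| := by
    calc D ≤ 2 * 1 * (h * |t| / 2) := by rw [hprod]; gcongr
      _ = h * |t| := by ring
  have hD2 : D ≤ (a + h / 2) * (h * t ^ 2) := by
    calc D ≤ 2 * ((2 * a + h) * |t| / 2) * (h * |t| / 2) := by rw [hprod]; gcongr
      _ = (a + h / 2) * (h * |t| ^ 2) := by ring
      _ = _ := by rw [sq_abs]
  have hK : ‖trapezoidKernel a h t‖ = D / (Real.pi * h * t ^ 2) := by
    have := Real.pi_pos
    rw [trapezoidKernel, Real.norm_eq_abs, abs_div,
      abs_of_pos (by positivity : 0 < Real.pi * h * t ^ 2)]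
  -- The product expands into four terms, each at most a multiple of ht² by one of the three bounds.
  -- The spare factor 1 + h|t| pays for the logarithm in `hlog`.
  have hmain : D * ((1 + |t|) * (1 + h * |t|)) ≤ (a + 2) * (Real.pi * h * t ^ 2) := by
    have e1 : D * |t| ≤ h * t ^ 2 := by
      calc D * |t| ≤ h * |t| * |t| := by gcongr
        _ = h * t ^ 2 := by rw [mul_assoc, ← sq, sq_abs]
    have e2 : D * (h * t ^ 2) ≤ 2 * (h * t ^ 2) := by gcongr
    have e3 : D * |t| * h ≤ h * t ^ 2 * 1 := by gcongr
    calc D * ((1 + |t|) * (1 + h * |t|)) = D + D * |t| + D * |t| * h + D * (h * |t| ^ 2) := by ring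
      _ ≤ (a + h / 2) * (h * t ^ 2) + h * t ^ 2 + h * t ^ 2 * 1 + 2 * (h * t ^ 2) := by
        rw [sq_abs]; linarith
      _ = (a + h / 2 + 4) * (h * t ^ 2) := by ring
      _ ≤ ((a + 2) * Real.pi) * (h * t ^ 2) := by
        gcongr
        nlinarith [Real.pi_gt_three]
      _ = _ := by ring
  have hL := one_le_one_add_log (by positivity : 0 ≤ 1 / h)
  have hlt := one_le_one_add_log hat.le
  -- Since 1 + |t| ≤ (1 + 1/h)(1 + h|t|), the logarithm splits into a part depending only on h and
  -- one in h|t|, whose square grows at most linearly.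
  have hlog : (1 + Real.log (1 + |t|)) ^ 2 ≤
      (1 + Real.log (1 + 1 / h)) ^ 2 * (4 * (1 + h * |t|)) := by
    have hlh := one_le_one_add_log (by positivity : 0 ≤ h * |t|)
    have h1 : Real.log (1 + |t|) ≤ Real.log (1 + 1 / h) + Real.log (1 + h * |t|) := by
      rw [← Real.log_mul (by positivity) (by positivity)]
      refine Real.log_le_log (by positivity) ?_
      have : (1 + 1 / h) * (1 + h * |t|) = 1 + |t| + (h * |t| + 1 / h) := by field_simp; ring
      rw [this]
      have : 0 ≤ h * |t| + 1 / h := by positivity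
      linarith
    calc (1 + Real.log (1 + |t|)) ^ 2
        ≤ ((1 + Real.log (1 + 1 / h)) * (1 + Real.log (1 + h * |t|))) ^ 2 := by
          refine pow_le_pow_left₀ (by linarith) ?_ 2
          nlinarith
      _ = (1 + Real.log (1 + 1 / h)) ^ 2 * (1 + Real.log (1 + h * |t|)) ^ 2 := mul_pow _ _ _
      _ ≤ _ := by gcongr; exact one_add_log_sq_le (by positivity)
  have hpi := Real.pi_pos
  rw [hK, weight, mul_one_div, div_le_div_iff₀ (by positivity) (by positivity)]
  calc D * ((1 + |t|) * (1 + Real.log (1 + |t|)) ^ 2)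
      ≤ D * ((1 + |t|) * ((1 + Real.log (1 + 1 / h)) ^ 2 * (4 * (1 + h * |t|)))) := by gcongr
    _ = 4 * (1 + Real.log (1 + 1 / h)) ^ 2 * (D * ((1 + |t|) * (1 + h * |t|))) := by ring
    _ ≤ 4 * (1 + Real.log (1 + 1 / h)) ^ 2 * ((a + 2) * (Real.pi * h * t ^ 2)) := by gcongr
    _ = _ := by ring

theorem measurable_trapezoidKernel (a h : ℝ) : Measurable (trapezoidKernel a h) := by
  unfold trapezoidKernel
  fun_prop

theorem continuous_triangle (b : ℝ) : Continuous (triangle b) := by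
  unfold triangle
  fun_prop

theorem integrable_triangle (b : ℝ) : Integrable (triangle b) := by
  refine (continuous_triangle b).integrable_of_hasCompactSupport
    (HasCompactSupport.intro (isCompact_Icc (a := -b) (b := b)) fun x hx => ?_)
  refine max_eq_left (sub_nonpos.2 (le_of_not_gt fun hlt => hx ?_))
  exact abs_le.1 hlt.le

/-- A trapezoid is a difference of two triangles divided by h, and `integral_triangle` computes
each; inversion then applies because the kernel is integrable. -/
theorem trapezoidKernel_fourier {a h : ℝ} (ha : 0 ≤ a) (hh : 0 < h) (hh1 : h ≤ 1) (x : ℝ) :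
    ∫ t : ℝ, (trapezoidKernel a h t : ℂ) * Complex.exp (-Complex.I * x * t) =
      ((triangle (a + h) x - triangle a x) / h : ℝ) := by
  have hK : Integrable fun t => (trapezoidKernel a h t : ℂ) :=
    ((integrable_weight.const_mul _).mono' (measurable_trapezoidKernel a h).aestronglyMeasurable
      (.of_forall (abs_trapezoidKernel_le ha hh hh1))).ofReal
  have htri : ∀ b t : ℝ, Integrable fun x : ℝ =>
      (triangle b x : ℂ) * Complex.exp (Complex.I * x * t) := fun b t => by
    refine (integrable_triangle b).ofReal.mul_bdd (c := 1)
      (Continuous.aestronglyMeasurable (by fun_prop)) (.of_forall fun x => ?_)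
    rw [show Complex.I * x * t = ((x * t : ℝ) : ℂ) * Complex.I by push_cast; ring,
      Complex.norm_exp_ofReal_mul_I]
  have hcont := continuous_triangle
  refine integral_mul_cexp_of_integral_mul_cexp
    (φ := fun x => ((triangle (a + h) x - triangle a x) / h : ℝ)) (by fun_prop)
    (((integrable_triangle _).sub (integrable_triangle _)).div_const h).ofReal hK
    (fun t ht => ?_) x
  have : ∀ x : ℝ, (((triangle (a + h) x - triangle a x) / h : ℝ) : ℂ) *
      Complex.exp (Complex.I * x * t) =
      ((triangle (a + h) x : ℂ) * Complex.exp (Complex.I * x * t) -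
        (triangle a x : ℂ) * Complex.exp (Complex.I * x * t)) / h := fun x => by
    push_cast
    ring
  simp only [this]
  rw [integral_div, integral_sub (htri _ _) (htri _ _), integral_triangle (by linarith) ht,
    integral_triangle ha ht, trapezoidKernel]
  have hpi : (Real.pi : ℂ) ≠ 0 := by exact_mod_cast Real.pi_ne_zero
  have ht' : (t : ℂ) ≠ 0 := by exact_mod_cast ht
  have hh' : (h : ℂ) ≠ 0 := by exact_mod_cast hh.ne'
  push_cast
  field_simp
  ring

/-- Under Landau's condition, partial sums arise from kernels dominated by a fixed integrable
weight, with constants growing more slowly than every exponential in the frequency. -/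
theorem exists_partialSum_kernel {lam : ℕ → ℝ} (hlam : IsFrequency lam)
    (hLC : LandauCondition lam) {δ : ℝ} (hδ : 0 < δ) :
    ∃ M : ℝ, 0 ≤ M ∧ ∀ N : ℕ, ∃ K : ℝ → ℂ, Measurable K ∧
      (∀ t, ‖K t‖ ≤ M * Real.exp (δ * lam N) * weight t) ∧
      ∀ n, ∫ t : ℝ, K t * Complex.exp (-Complex.I * lam n * t) = if n ≤ N then 1 else 0 := by
  -- With E = e^{δλ_N/3}, the kernel bound costs three factors E: one for λ_N + 2 and two for the
  -- squared logarithm. Together they make e^{δλ_N}.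
  obtain ⟨C, hC, hgap⟩ := hLC (δ / 3) (by positivity)
  set c := min C 1 with hc
  have hc0 : 0 < c := lt_min hC one_pos
  have hc1 : c ≤ 1 := min_le_right _ _
  set R := 2 + Real.log (2 / c) with hR
  have hlogc : 0 ≤ Real.log (2 / c) := Real.log_nonneg (by rw [le_div_iff₀ hc0]; linarith)
  refine ⟨4 * (3 / δ + 2) * R ^ 2, by positivity, fun N => ?_⟩
  set E := Real.exp (δ / 3 * lam N) with hE
  have hlamN := hlam.nonneg N
  have hE1 : 1 ≤ E := Real.one_le_exp (by positivity)
  have hElam : δ / 3 * lam N ≤ E := by linarith [Real.add_one_le_exp (δ / 3 * lam N)]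
  -- The ramp must end by λ_{N+1}, and the kernel bound requires h ≤ 1.
  set h := min (lam (N + 1) - lam N) 1 with hh
  have hgapN : 0 < lam (N + 1) - lam N := sub_pos.2 (hlam.strictMono N.lt_succ_self)
  have hh0 : 0 < h := lt_min hgapN one_pos
  have hh1 : h ≤ 1 := min_le_right _ _
  have hhc : c * Real.exp (-E) ≤ h := by
    refine le_min ((mul_le_mul_of_nonneg_right (min_le_left _ _) (Real.exp_pos _).le).trans
      (hgap N)) ?_
    exact mul_le_one₀ hc1 (Real.exp_pos _).le (Real.exp_le_one_iff.2 (by linarith))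
  have hlog : 1 + Real.log (1 + 1 / h) ≤ R * E := by
    have h1 : 1 + 1 / h ≤ 2 / c * Real.exp E := by
      have e1 : 1 / h ≤ 1 / c * Real.exp E := by
        rw [div_mul_eq_mul_div, one_mul, div_le_div_iff₀ hh0 hc0, one_mul]
        calc c = c * Real.exp (-E) * Real.exp E := by rw [mul_assoc, ← Real.exp_add]; simp
          _ ≤ h * Real.exp E := by gcongr
          _ = _ := mul_comm _ _
      have e2 : 1 ≤ 1 / c * Real.exp E :=
        one_le_mul_of_one_le_of_one_le (by rwa [le_div_iff₀ hc0, one_mul])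
          (Real.one_le_exp (by linarith))
      calc 1 + 1 / h ≤ 1 / c * Real.exp E + 1 / c * Real.exp E := add_le_add e2 e1
        _ = _ := by ring
    have h2 : Real.log (1 + 1 / h) ≤ Real.log (2 / c) + E := by
      refine (Real.log_le_log (by positivity) h1).trans_eq ?_
      rw [Real.log_mul (by positivity) (by positivity), Real.log_exp]
    nlinarith
  have hL := one_le_one_add_log (by positivity : 0 ≤ 1 / h)
  refine ⟨fun t => (trapezoidKernel (lam N) h t : ℂ),
    Complex.measurable_ofReal.comp (measurable_trapezoidKernel _ _), fun t => ?_, fun n => ?_⟩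
  · rw [Complex.norm_real]
    refine (abs_trapezoidKernel_le hlamN hh0 hh1 t).trans ?_
    have hw := (weight_pos t).le
    gcongr ?_ * _
    have h1 : lam N + 2 ≤ (3 / δ + 2) * E := by
      have : lam N ≤ 3 / δ * E := by
        calc lam N = 3 / δ * (δ / 3 * lam N) := by field_simp
          _ ≤ _ := by gcongr
      linarith
    have hE3 : Real.exp (δ * lam N) = E ^ 3 := by
      rw [hE, ← Real.exp_nat_mul]
      congr 1
      push_cast
      ring
    calc 4 * (lam N + 2) * (1 + Real.log (1 + 1 / h)) ^ 2
        ≤ 4 * ((3 / δ + 2) * E) * (R * E) ^ 2 := by gcongr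
      _ = _ := by rw [hE3]; ring
  · have := trapezoidKernel_fourier hlamN hh0 hh1 (lam n)
    rw [this]
    simp only [triangle, abs_of_nonneg (hlam.nonneg n)]
    split_ifs with hn
    · have : lam n ≤ lam N := hlam.strictMono.monotone hn
      rw [max_eq_right (by linarith), max_eq_right (by linarith)]
      rw [show (lam N + h - lam n - (lam N - lam n)) / h = 1 by field_simp; ring]
      simp
    · have h1 : lam (N + 1) ≤ lam n := hlam.strictMono.monotone (by omega)
      have h2 : h ≤ lam (N + 1) - lam N := min_le_left _ _
      rw [max_eq_left (by linarith), max_eq_left (by linarith)]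
      simp

end PartialSumKernel

/-! ### Convolution along the one-parameter subgroup and its Fourier coefficients. -/

section LineConvolution

variable {G : Type*} [CommGroup G] [TopologicalSpace G] [IsTopologicalGroup G] [CompactSpace G]
  [MeasurableSpace G] [BorelSpace G] {β : Multiplicative ℝ →* G}

/-- For each fixed t the map on G is a translation, which preserves Haar measure. Through this
shear, statements on G transfer to orbits by Fubini. -/
theorem measurePreserving_shear (hβ : Continuous β) :
    MeasurePreserving (fun z : ℝ × G => (z.1, z.2 * β (Multiplicative.ofAdd z.1)))
      (volume.prod (haarProb G)) (volume.prod (haarProb G)) := by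
  refine (MeasurePreserving.id (volume : Measure ℝ)).skew_product
    (g := fun t ω => ω * β (Multiplicative.ofAdd t)) ?_
    (.of_forall fun t => map_mul_right_eq_self _ _)
  have h : Continuous fun z : ℝ × G => z.2 * β (Multiplicative.ofAdd z.1) :=
    continuous_snd.mul (hβ.comp (continuous_ofAdd.comp continuous_fst))
  exact h.measurable

/-- A property that holds almost everywhere on `G` holds at almost every point of almost every
orbit of the one-parameter subgroup. -/
theorem ae_ae_shift (hβ : Continuous β) {p : G → Prop} (hp : ∀ᵐ ω ∂(haarProb G), p ω) :
    ∀ᵐ ω ∂(haarProb G), ∀ᵐ t : ℝ, p (ω * β (Multiplicative.ofAdd t)) := by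
  have h1 : ∀ᵐ z ∂((volume : Measure ℝ).prod (haarProb G)), p z.2 :=
    Measure.quasiMeasurePreserving_snd.ae hp
  have h2 := (measurePreserving_shear hβ).quasiMeasurePreserving.ae h1
  have h3 := (Measure.measurePreserving_swap (μ := haarProb G)
    (ν := (volume : Measure ℝ))).quasiMeasurePreserving.ae h2
  exact Measure.ae_ae_of_ae_prod h3

theorem integrable_restrict_mul (hβ : Continuous β) {f : G → ℂ} (hf : Integrable f (haarProb G))
    {K : ℝ → ℂ} (hK : Integrable K) :
    Integrable (fun z : ℝ × G => restrict β f z.2 z.1 * K z.1) (volume.prod (haarProb G)) := by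
  have h := (measurePreserving_shear hβ).integrable_comp_of_integrable (hK.mul_prod hf)
  refine h.congr (.of_forall fun z => ?_)
  exact mul_comm _ _

/-- The convolution `∫ f(ω β(t)) K(t) dt` of `f` with a kernel on the line. -/
def lineConv (β : Multiplicative ℝ →* G) (f : G → ℂ) (K : ℝ → ℂ) (ω : G) : ℂ :=
  ∫ t : ℝ, restrict β f ω t * K t

theorem integrable_lineConv (hβ : Continuous β) {f : G → ℂ} (hf : Integrable f (haarProb G))
    {K : ℝ → ℂ} (hK : Integrable K) : Integrable (lineConv β f K) (haarProb G) :=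
  (integrable_restrict_mul hβ hf hK).integral_prod_right

/-- Translating f by β(t) multiplies its coefficient at χ by χ(β(t)); Fubini integrates this factor
against K. -/
theorem fourierCoeff_lineConv (hβ : Continuous β) {f : G → ℂ} (hf : Integrable f (haarProb G))
    {K : ℝ → ℂ} (hK : Integrable K) (χ : G →ₜ* Circle) :
    fourierCoeff (lineConv β f K) χ =
      fourierCoeff f χ * ∫ t : ℝ, K t * (χ (β (Multiplicative.ofAdd t)) : ℂ) := by
  have hχ : Continuous fun ω : G => starRingEnd ℂ (χ ω : ℂ) := by fun_prop
  have hint : Integrable (fun z : ℝ × G => restrict β f z.2 z.1 * K z.1 *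
      starRingEnd ℂ (χ z.2 : ℂ)) (volume.prod (haarProb G)) :=
    (integrable_restrict_mul hβ hf hK).mul_bdd (c := 1)
      (hχ.measurable.comp measurable_snd).aestronglyMeasurable
      (.of_forall fun z => by rw [RCLike.norm_conj, Circle.norm_coe])
  have hshift : ∀ t : ℝ, ∫ ω, restrict β f ω t * K t * starRingEnd ℂ (χ ω : ℂ) ∂(haarProb G) =
      fourierCoeff f χ * (K t * (χ (β (Multiplicative.ofAdd t)) : ℂ)) := fun t => by
    rw [fourierCoeff, ← integral_mul_const,
      ← integral_mul_right_eq_self (fun ω => f ω *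
      starRingEnd ℂ (χ ω : ℂ) * (K t * (χ (β (Multiplicative.ofAdd t)) : ℂ)))
      (β (Multiplicative.ofAdd t))]
    congr 1 with ω
    have : (χ (β (Multiplicative.ofAdd t)) : ℂ) *
        starRingEnd ℂ (χ (β (Multiplicative.ofAdd t)) : ℂ) = 1 := by
      rw [← Circle.coe_inv_eq_conj, ← Circle.coe_mul, mul_inv_cancel, Circle.coe_one]
    rw [map_mul, Circle.coe_mul, map_mul, restrict]
    linear_combination -(f (ω * β (Multiplicative.ofAdd t)) * K t *
      starRingEnd ℂ (χ ω : ℂ)) * this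
  calc fourierCoeff (lineConv β f K) χ
      = ∫ ω, (∫ t : ℝ, restrict β f ω t * K t * starRingEnd ℂ (χ ω : ℂ)) ∂(haarProb G) := by
        simp only [fourierCoeff, lineConv, ← integral_mul_const]
    _ = ∫ t : ℝ, ∫ ω, restrict β f ω t * K t * starRingEnd ℂ (χ ω : ℂ) ∂(haarProb G) :=
        (integral_integral_swap hint).symm
    _ = ∫ t : ℝ, fourierCoeff f χ * (K t * (χ (β (Multiplicative.ofAdd t)) : ℂ)) := by
        simp only [hshift]
    _ = _ := integral_const_mul _ _

theorem integral_character_eq_zero {χ : G →ₜ* Circle} (hχ : χ ≠ 1) :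
    ∫ ω, (χ ω : ℂ) ∂(haarProb G) = 0 := by
  obtain ⟨y, hy⟩ : ∃ y, χ y ≠ 1 := by
    by_contra! h
    exact hχ (ContinuousMonoidHom.ext h)
  have h1 : ∫ ω, (χ ω : ℂ) ∂(haarProb G) = (χ y : ℂ) * ∫ ω, (χ ω : ℂ) ∂(haarProb G) := by
    rw [← integral_const_mul, ← integral_mul_left_eq_self _ y]
    simp
  by_contra h0
  exact hy (Circle.ext ((mul_eq_right₀ h0).1 h1.symm))

theorem fourierCoeff_character (χ ψ : G →ₜ* Circle) [Decidable (χ = ψ)] :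
    fourierCoeff (fun ω => (χ ω : ℂ)) ψ = if χ = ψ then 1 else 0 := by
  have h : fourierCoeff (fun ω => (χ ω : ℂ)) ψ = ∫ ω, ((χ * ψ⁻¹) ω : ℂ) ∂(haarProb G) := by
    rw [fourierCoeff]
    congr 1 with ω
    rw [← Circle.coe_inv_eq_conj, ← Circle.coe_mul]
    rfl
  rw [h]
  split_ifs with he
  · subst he
    rw [mul_inv_cancel]
    simp
  · exact integral_character_eq_zero fun h1 => he (mul_inv_eq_one.1 h1)

end LineConvolution

/-! ### Fourier coefficients at the frequency characters. -/

section FreqChar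

variable {G : Type*} [CommGroup G] [TopologicalSpace G] {lam : ℕ → ℝ} {β : Multiplicative ℝ →* G}

theorem freqChar_injective (hlam : IsFrequency lam) (hβ : IsFreqDirichletGroup lam β) :
    Function.Injective (freqChar hβ) := by
  intro n m h
  by_contra hnm
  have hne : lam n - lam m ≠ 0 := sub_ne_zero.2 fun he => hnm (hlam.strictMono.injective he)
  -- At this t the exponentials at λ_n and λ_m differ by the factor e^{-iπ} = -1, so equality would
  -- make 1 an even integer.
  have h1 := freqChar_restrictsTo hβ n (Real.pi / (lam n - lam m))
  rw [h, freqChar_restrictsTo hβ m, Complex.exp_eq_exp_iff_exists_int] at h1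
  obtain ⟨k, hk⟩ := h1
  have hne' : (lam n : ℂ) - lam m ≠ 0 := by exact_mod_cast hne
  have hpi : (Real.pi : ℂ) ≠ 0 := by exact_mod_cast Real.pi_ne_zero
  push_cast at hk
  field_simp at hk
  have h2 : ((1 : ℤ) : ℂ) = ((2 * k : ℤ) : ℂ) := by
    push_cast
    exact mul_right_cancel₀ hne' (by linear_combination hk)
  have h3 : (1 : ℤ) = 2 * k := by exact_mod_cast h2
  omega

variable [IsTopologicalGroup G] [CompactSpace G] [MeasurableSpace G] [BorelSpace G]

theorem integrable_sum_freqChar (hβ : IsFreqDirichletGroup lam β) (b : ℕ → ℂ) (N : ℕ) :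
    Integrable (fun ω => ∑ n ∈ Finset.range N, b n * (freqChar hβ n ω : ℂ)) (haarProb G) :=
  integrable_finsetSum _ fun n _ => (integrable_continuousMap (charMap (freqChar hβ n))).const_mul _

theorem fourierCoeff_sum_freqChar (hβ : IsFreqDirichletGroup lam β) (b : ℕ → ℂ) (N : ℕ)
    (χ : G →ₜ* Circle) [∀ n, Decidable (freqChar hβ n = χ)] :
    fourierCoeff (fun ω => ∑ n ∈ Finset.range N, b n * (freqChar hβ n ω : ℂ)) χ =
      ∑ n ∈ Finset.range N, if freqChar hβ n = χ then b n else 0 := by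
  rw [fourierCoeff]
  simp only [Finset.sum_mul, mul_assoc]
  rw [integral_finsetSum]
  · refine Finset.sum_congr rfl fun n _ => ?_
    rw [integral_const_mul, ← fourierCoeff, fourierCoeff_character, mul_ite, mul_one, mul_zero]
  · intro n _
    refine Integrable.const_mul ?_ _
    exact integrable_continuousMap (charMap (freqChar hβ n) * star (charMap χ))

theorem fourierCoeff_sum_freqChar_apply (hlam : IsFrequency lam) (hβ : IsFreqDirichletGroup lam β)
    (b : ℕ → ℂ) (N m : ℕ) :
    fourierCoeff (fun ω => ∑ n ∈ Finset.range N, b n * (freqChar hβ n ω : ℂ)) (freqChar hβ m) =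
      if m < N then b m else 0 := by
  classical
  rw [fourierCoeff_sum_freqChar]
  simp [(freqChar_injective hlam hβ).eq_iff]

theorem fourierCoeff_sum_freqChar_of_notMem (hβ : IsFreqDirichletGroup lam β)
    (b : ℕ → ℂ) (N : ℕ) {χ : G →ₜ* Circle} (hχ : χ ∉ Set.range (freqChar hβ)) :
    fourierCoeff (fun ω => ∑ n ∈ Finset.range N, b n * (freqChar hβ n ω : ℂ)) χ = 0 := by
  classical
  rw [fourierCoeff_sum_freqChar]
  exact Finset.sum_eq_zero fun n _ => if_neg fun h => hχ ⟨n, h⟩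

theorem fourierCoeff_lineConv_freqChar (hβ : IsFreqDirichletGroup lam β) {f : G → ℂ}
    (hf : Integrable f (haarProb G)) {K : ℝ → ℂ} (hK : Integrable K) (n : ℕ) :
    fourierCoeff (lineConv β f K) (freqChar hβ n) =
      fourierCoeff f (freqChar hβ n) * ∫ t : ℝ, K t * Complex.exp (-Complex.I * lam n * t) := by
  rw [fourierCoeff_lineConv hβ.continuous hf hK]
  simp only [freqChar_restrictsTo hβ n _]

theorem fourierCoeff_lineConv_of_notMem (hβ : IsFreqDirichletGroup lam β) {f : G → ℂ}
    (hf : MemHardyOne hβ f) {K : ℝ → ℂ} (hK : Integrable K) {χ : G →ₜ* Circle}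
    (hχ : χ ∉ Set.range (freqChar hβ)) : fourierCoeff (lineConv β f K) χ = 0 := by
  rw [fourierCoeff_lineConv hβ.continuous (memLp_one_iff_integrable.1 hf.memLp) hK,
    hf.fourier_support χ hχ, zero_mul]

variable [T2Space G]

theorem ae_eq_of_fourierCoeff {f g : G → ℂ} (hf : Integrable f (haarProb G))
    (hg : Integrable g (haarProb G)) (h : ∀ χ : G →ₜ* Circle, fourierCoeff f χ = fourierCoeff g χ) :
    f =ᵐ[haarProb G] g := by
  refine (sub_ae_eq_zero _ _).1 (ae_eq_zero_of_fourierCoeff (hf.sub hg) fun χ => ?_)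
  have hint : ∀ {f : G → ℂ}, Integrable f (haarProb G) →
      Integrable (fun ω => f ω * starRingEnd ℂ (χ ω : ℂ)) (haarProb G) := fun hf =>
    hf.mul_bdd (c := 1) (Continuous.aestronglyMeasurable (by fun_prop))
      (.of_forall fun z => by rw [RCLike.norm_conj, Circle.norm_coe])
  have : fourierCoeff (f - g) χ = fourierCoeff f χ - fourierCoeff g χ := by
    simp only [fourierCoeff, Pi.sub_apply, sub_mul]
    exact integral_sub (hint hf) (hint hg)
  rw [this, h, sub_self]

/-- A kernel with the right Fourier transform produces the partial sums of the vertical limits. -/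
theorem sum_verticalLimit_ae_eq_lineConv (hlam : IsFrequency lam)
    (hβ : IsFreqDirichletGroup lam β) {a : ℕ → ℂ} {f : G → ℂ} (hf : IsAssociated hβ a f)
    {K : ℝ → ℂ} (hK : Integrable K) {N : ℕ}
    (hKhat : ∀ n, ∫ t : ℝ, K t * Complex.exp (-Complex.I * lam n * t) = if n < N then 1 else 0) :
    ∀ᵐ ω ∂(haarProb G), ∑ n ∈ Finset.range N, verticalLimit hβ a ω n = lineConv β f K ω := by
  have hfi := memLp_one_iff_integrable.1 hf.mem.memLp
  refine ae_eq_of_fourierCoeff (integrable_sum_freqChar hβ a N)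
    (integrable_lineConv hβ.continuous hfi hK) fun χ => ?_
  by_cases hχ : χ ∈ Set.range (freqChar hβ)
  · obtain ⟨m, rfl⟩ := hχ
    rw [fourierCoeff_lineConv_freqChar hβ hfi hK, hKhat, ← hf.coeff, mul_ite, mul_one, mul_zero]
    exact fourierCoeff_sum_freqChar_apply hlam hβ a N m
  · rw [fourierCoeff_lineConv_of_notMem hβ hf.mem hK hχ]
    exact fourierCoeff_sum_freqChar_of_notMem hβ a N hχ

end FreqChar

/-! ### Summation by parts for Dirichlet series. -/

section AbelSummation

theorem norm_cexp_sub_cexp_le {a b δ : ℝ} (hab : a ≤ b) (ha : 0 ≤ a) (hδ : 0 < δ) {s : ℂ}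
    (hs : δ ≤ s.re) : ‖Complex.exp (-(a : ℂ) * s) - Complex.exp (-(b : ℂ) * s)‖ ≤
      ‖s‖ / δ * (Real.exp (-δ * a) - Real.exp (-δ * b)) := by
  have h1 : ∀ x : ℝ, HasDerivAt (fun x : ℝ => -Complex.exp (-(x : ℂ) * s))
      (s * Complex.exp (-(x : ℂ) * s)) x := fun x => by
    refine (((Complex.ofRealCLM.hasDerivAt (x := x)).neg.mul_const s).cexp.neg).congr_deriv ?_
    simp
    ring
  have h2 : ∀ x : ℝ, HasDerivAt (fun x : ℝ => -(‖s‖ / δ * Real.exp (-δ * x)))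
      (‖s‖ * Real.exp (-δ * x)) x := fun x => by
    refine ((((hasDerivAt_id x).const_mul (-δ)).exp.const_mul (‖s‖ / δ)).neg).congr_deriv ?_
    simp
    field_simp
  have e1 := intervalIntegral.integral_eq_sub_of_hasDerivAt (a := a) (b := b) (fun x _ => h1 x)
    (Continuous.intervalIntegrable (by fun_prop) _ _)
  have e2 := intervalIntegral.integral_eq_sub_of_hasDerivAt (a := a) (b := b) (fun x _ => h2 x)
    (Continuous.intervalIntegrable (by fun_prop) _ _)
  rw [show Complex.exp (-(a : ℂ) * s) - Complex.exp (-(b : ℂ) * s) =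
      -Complex.exp (-(b : ℂ) * s) - -Complex.exp (-(a : ℂ) * s) by ring, ← e1,
    show ‖s‖ / δ * (Real.exp (-δ * a) - Real.exp (-δ * b)) =
      -(‖s‖ / δ * Real.exp (-δ * b)) - -(‖s‖ / δ * Real.exp (-δ * a)) by ring, ← e2]
  refine intervalIntegral.norm_integral_le_of_norm_le hab (.of_forall fun x hx => ?_)
    (Continuous.intervalIntegrable (by fun_prop) _ _)
  rw [norm_mul, Complex.norm_exp]
  gcongr
  have hx0 : 0 ≤ x := ha.trans hx.1.le
  simp only [Complex.mul_re, Complex.neg_re, Complex.ofReal_re, Complex.neg_im, Complex.ofReal_im]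
  nlinarith

/-- The terms of a Dirichlet series after summation by parts. -/
def abelTerm (lam : ℕ → ℝ) (c : ℕ → ℂ) (s : ℂ) (n : ℕ) : ℂ :=
  (∑ k ∈ Finset.range (n + 1), c k) *
    (Complex.exp (-(lam n : ℂ) * s) - Complex.exp (-(lam (n + 1) : ℂ) * s))

theorem sum_range_succ_eq_abel (lam : ℕ → ℝ) (c : ℕ → ℂ) (s : ℂ) (N : ℕ) :
    ∑ n ∈ Finset.range (N + 1), c n * Complex.exp (-(lam n : ℂ) * s) =
      (∑ n ∈ Finset.range (N + 1), c n) * Complex.exp (-(lam N : ℂ) * s) +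
        ∑ n ∈ Finset.range N, abelTerm lam c s n := by
  induction N with
  | zero => simp
  | succ N ih =>
    rw [Finset.sum_range_succ, ih, Finset.sum_range_succ (abelTerm lam c s),
      Finset.sum_range_succ c (N + 1), abelTerm]
    ring

variable {lam : ℕ → ℝ} (hlam : IsFrequency lam) {δ : ℝ} (hδ : 0 < δ)

include hlam hδ

theorem exp_diff_nonneg (n : ℕ) :
    0 ≤ Real.exp (-δ * lam n) - Real.exp (-δ * lam (n + 1)) := by
  have := hlam.strictMono n.lt_succ_self
  rw [sub_nonneg, Real.exp_le_exp]
  nlinarith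

theorem sum_exp_diff_le_one (N : ℕ) :
    ∑ n ∈ Finset.range N, (Real.exp (-δ * lam n) - Real.exp (-δ * lam (n + 1))) ≤ 1 := by
  rw [Finset.sum_range_sub']
  have h1 : Real.exp (-δ * lam 0) ≤ 1 :=
    Real.exp_le_one_iff.2 (by nlinarith [hlam.nonneg 0])
  linarith [Real.exp_pos (-δ * lam N)]

theorem summable_exp_diff :
    Summable fun n => Real.exp (-δ * lam n) - Real.exp (-δ * lam (n + 1)) :=
  summable_of_sum_range_le (exp_diff_nonneg hlam hδ) (sum_exp_diff_le_one hlam hδ)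

variable {c : ℕ → ℂ} {M : ℝ} (hM : 0 ≤ M)
  (hc : ∀ N, ‖∑ n ∈ Finset.range (N + 1), c n‖ ≤ M * Real.exp (δ * lam N))
  {s : ℂ} (hs : 2 * δ ≤ s.re)

include hM hc hs

/-- Half of the decay e^{-2δλ} absorbs the growth of the partial sums: with y, z the values of
e^{-δλ} at consecutive frequencies, y² - z² = (y - z)(y + z), and e^{δλ_n}(y + z) ≤ 2. What remains
telescopes. -/
theorem norm_abelTerm_le (n : ℕ) : ‖abelTerm lam c s n‖ ≤
    M * ‖s‖ / δ * (Real.exp (-δ * lam n) - Real.exp (-δ * lam (n + 1))) := by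
  have hmono := (hlam.strictMono n.lt_succ_self).le
  have h1 := norm_cexp_sub_cexp_le hmono (hlam.nonneg n) (by positivity : 0 < 2 * δ) hs
  have hsq : ∀ x : ℝ, Real.exp (-(2 * δ) * x) = Real.exp (-δ * x) ^ 2 := fun x => by
    rw [← Real.exp_nat_mul]
    congr 1
    push_cast
    ring
  rw [hsq, hsq] at h1
  have hd := exp_diff_nonneg hlam hδ n
  have hinv : Real.exp (δ * lam n) * Real.exp (-δ * lam n) = 1 := by
    rw [← Real.exp_add]
    simp
  set y := Real.exp (-δ * lam n)
  set z := Real.exp (-δ * lam (n + 1))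
  have hz : 0 < z := Real.exp_pos _
  rw [abelTerm, norm_mul]
  calc _ ≤ M * Real.exp (δ * lam n) * (‖s‖ / (2 * δ) * (y ^ 2 - z ^ 2)) :=
        mul_le_mul (hc n) h1 (norm_nonneg _) (by positivity)
    _ = M * ‖s‖ / (2 * δ) * (y - z) * (Real.exp (δ * lam n) * (y + z)) := by ring
    _ ≤ M * ‖s‖ / (2 * δ) * (y - z) * (Real.exp (δ * lam n) * (y + y)) := by
        gcongr
        linarith
    _ = M * ‖s‖ / δ * (y - z) * (Real.exp (δ * lam n) * y) := by field_simp; ring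
    _ = _ := by rw [hinv, mul_one]

omit hδ in
theorem norm_sum_mul_cexp_le (N : ℕ) :
    ‖(∑ n ∈ Finset.range (N + 1), c n) * Complex.exp (-(lam N : ℂ) * s)‖ ≤
      M * Real.exp (-δ * lam N) := by
  rw [norm_mul, Complex.norm_exp]
  calc _ ≤ M * Real.exp (δ * lam N) * Real.exp (-(2 * δ) * lam N) := by
        refine mul_le_mul (hc N) (Real.exp_le_exp.2 ?_) (Real.exp_pos _).le (by positivity)
        simp only [Complex.mul_re, Complex.neg_re, Complex.ofReal_re, Complex.neg_im,
          Complex.ofReal_im]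
        nlinarith [hlam.nonneg N]
    _ = _ := by
        rw [mul_assoc, ← Real.exp_add]
        congr 2
        ring

theorem summable_abelTerm : Summable (abelTerm lam c s) :=
  Summable.of_norm_bounded ((summable_exp_diff hlam hδ).mul_left _)
    (norm_abelTerm_le hlam hδ hM hc hs)

theorem seriesConvergesTo_tsum_abelTerm :
    SeriesConvergesTo lam c s (∑' n, abelTerm lam c s n) := by
  rw [SeriesConvergesTo, ← tendsto_add_atTop_iff_nat 1]
  simp only [sum_range_succ_eq_abel]
  have h0 : Tendsto (fun N => M * Real.exp (-δ * lam N)) atTop (𝓝 0) := by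
    have h1 : Tendsto (fun N => -δ * lam N) atTop atBot :=
      hlam.tendsto.const_mul_atTop_of_neg (by linarith)
    simpa using (Real.tendsto_exp_atBot.comp h1).const_mul M
  have h2 := squeeze_zero_norm (norm_sum_mul_cexp_le hlam hM hc hs) h0
  simpa using h2.add (summable_abelTerm hlam hδ hM hc hs).hasSum.tendsto_sum_nat

/-- Uniformity in N and linearity in M matter: with M proportional to `majorant`, this becomes an
integrable dominating function on G. -/
theorem norm_partialSum_le (N : ℕ) :
    ‖∑ n ∈ Finset.range N, c n * Complex.exp (-(lam n : ℂ) * s)‖ ≤ M * (1 + ‖s‖ / δ) := by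
  rcases N with _ | N
  · simp only [Finset.range_zero, Finset.sum_empty, norm_zero]
    positivity
  rw [sum_range_succ_eq_abel]
  have h1 : ‖∑ n ∈ Finset.range N, abelTerm lam c s n‖ ≤ M * ‖s‖ / δ := by
    refine (norm_sum_le_of_le _ fun n _ => norm_abelTerm_le hlam hδ hM hc hs n).trans ?_
    rw [← Finset.mul_sum]
    exact mul_le_of_le_one_right (by positivity) (sum_exp_diff_le_one hlam hδ N)
  have h2 : M * Real.exp (-δ * lam N) ≤ M :=
    mul_le_of_le_one_right hM (Real.exp_le_one_iff.2 (by nlinarith [hlam.nonneg N]))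
  calc _ ≤ M + M * ‖s‖ / δ :=
        (norm_add_le _ _).trans (add_le_add ((norm_sum_mul_cexp_le hlam hM hc hs N).trans h2) h1)
    _ = _ := by ring

omit hδ hM hc hs

theorem continuousAt_tsum_abelTerm {u : ℝ} (hu : 0 < u)
    (hc : ∀ δ > 0, ∃ M, 0 ≤ M ∧
      ∀ N, ‖∑ n ∈ Finset.range (N + 1), c n‖ ≤ M * Real.exp (δ * lam N)) :
    ContinuousAt (fun u : ℝ => ∑' n, abelTerm lam c u n) u := by
  -- Twice u/4 is the left end of the interval (u/2, 2u), so one summable bound serves the whole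
  -- neighbourhood of u.
  obtain ⟨M, hM, hc⟩ := hc (u / 4) (by positivity)
  refine ContinuousOn.continuousAt (s := Set.Ioo (u / 2) (2 * u)) ?_
    (Ioo_mem_nhds (by linarith) (by linarith))
  refine continuousOn_tsum (fun n => Continuous.continuousOn (by unfold abelTerm; fun_prop))
    ((summable_exp_diff hlam (δ := u / 4) (by positivity)).mul_left (M * (2 * u) / (u / 4)))
    fun n v hv => ?_
  refine (norm_abelTerm_le hlam (δ := u / 4) (by positivity) hM hc
    (by simp only [Complex.ofReal_re]; linarith [hv.1]) n).trans ?_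
  have := exp_diff_nonneg hlam (δ := u / 4) (by positivity) n
  have hv0 : 0 < v := by linarith [hv.1]
  gcongr
  rw [Complex.norm_real, Real.norm_of_nonneg hv0.le]
  exact hv.2.le

end AbelSummation

/-! ### Kernel estimates along a single orbit. -/

section Orbits

variable {G : Type*} [CommGroup G] {β : Multiplicative ℝ →* G}

theorem measurable_poisson (u : ℝ) : Measurable (poisson u) := by
  unfold poisson
  fun_prop

theorem restrict_mul (β : Multiplicative ℝ →* G) (f : G → ℂ) (ω : G) (t x : ℝ) :
    restrict β f (ω * β (Multiplicative.ofAdd t)) x = restrict β f ω (t + x) := by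
  rw [restrict, restrict, ofAdd_add, map_mul, mul_assoc]

/-- The weighted integral of `|f|` along an orbit, which controls all partial sums. -/
def majorant (β : Multiplicative ℝ →* G) (f : G → ℂ) (ω : G) : ℝ :=
  ∫ t : ℝ, ‖restrict β f ω t‖ * weight t

theorem majorant_nonneg (β : Multiplicative ℝ →* G) (f : G → ℂ) (ω : G) : 0 ≤ majorant β f ω :=
  integral_nonneg fun t => mul_nonneg (norm_nonneg _) (weight_pos t).le

theorem norm_mul_weight (z : ℂ) (t : ℝ) : ‖z * (weight t : ℂ)‖ = ‖z‖ * weight t := by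
  rw [norm_mul, Complex.norm_real, Real.norm_of_nonneg (weight_pos t).le]

section Orbit

variable {f : G → ℂ} {ω : G} (hf : Integrable fun t => restrict β f ω t * (weight t : ℂ))

include hf

theorem integrable_restrict_mul_of_le {K : ℝ → ℂ} (hK : Measurable K) {C : ℝ}
    (hKC : ∀ t, ‖K t‖ ≤ C * weight t) : Integrable fun t => restrict β f ω t * K t := by
  have h := hf.mul_bdd (c := C) (g := fun t => K t / weight t)
    (hK.div (Complex.measurable_ofReal.comp measurable_weight)).aestronglyMeasurable
    (.of_forall fun t => by
      rw [norm_div, Complex.norm_real, Real.norm_of_nonneg (weight_pos t).le,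
        div_le_iff₀ (weight_pos t)]
      exact hKC t)
  refine h.congr (.of_forall fun t => ?_)
  have : (weight t : ℂ) ≠ 0 := by exact_mod_cast (weight_pos t).ne'
  field_simp

theorem norm_lineConv_le {K : ℝ → ℂ} {C : ℝ} (hKC : ∀ t, ‖K t‖ ≤ C * weight t) :
    ‖lineConv β f K ω‖ ≤ C * majorant β f ω := by
  rw [majorant, ← integral_const_mul]
  refine norm_integral_le_of_norm_le ?_ (.of_forall fun t => ?_)
  · simpa only [norm_mul_weight] using hf.norm.const_mul C
  · rw [norm_mul, mul_left_comm]
    exact mul_le_mul_of_nonneg_left (hKC t) (norm_nonneg _)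

theorem integrable_restrict_mul_poisson {u : ℝ} (hu : 0 < u) :
    Integrable fun t => restrict β f ω t * (poisson u t : ℂ) :=
  integrable_restrict_mul_of_le hf (Complex.measurable_ofReal.comp (measurable_poisson u))
    fun t => by rw [Complex.norm_real]; exact abs_poisson_le hu t

theorem locallyIntegrable_restrict : LocallyIntegrable (restrict β f ω) volume := by
  rw [locallyIntegrable_iff]
  intro k hk
  have hc : Continuous fun t => ((weight t)⁻¹ : ℂ) := by
    have hw : Continuous weight := by
      unfold weight
      refine continuous_const.div ?_ fun t => ?_
      · refine Continuous.mul (by fun_prop) ((continuous_const.add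
          (Continuous.log (by fun_prop) fun t => ?_)).pow 2)
        positivity
      · have := one_le_one_add_log (abs_nonneg t)
        positivity
    exact (Complex.continuous_ofReal.comp hw).inv₀ fun t =>
      Complex.ofReal_ne_zero.2 (weight_pos t).ne'
  refine (hf.integrableOn.mul_continuousOn hc.continuousOn hk).congr_fun (fun t _ => ?_)
    hk.measurableSet
  have : (weight t : ℂ) ≠ 0 := by exact_mod_cast (weight_pos t).ne'
  simp only
  rw [mul_assoc, mul_inv_cancel₀ this, mul_one]

theorem continuousAt_lineConv_poisson {u : ℝ} (hu : 0 < u) :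
    ContinuousAt (fun u => lineConv β f (fun t => (poisson u t : ℂ)) ω) u := by
  have hnear : ∀ᶠ v in 𝓝 u, v ∈ Set.Ioo (u / 2) (2 * u) :=
    Ioo_mem_nhds (by linarith) (by linarith)
  refine continuousAt_of_dominated (bound := fun t => 8 * (2 * u + 1 / (u / 2)) *
    (‖restrict β f ω t‖ * weight t)) ?_ ?_ ?_ (.of_forall fun t => ?_)
  · filter_upwards [hnear] with v hv
    exact (integrable_restrict_mul_poisson hf (by linarith [hv.1])).aestronglyMeasurable
  · filter_upwards [hnear] with v hv
    refine .of_forall fun t => ?_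
    have hv0 : 0 < v := by linarith [hv.1]
    have hw := (weight_pos t).le
    rw [norm_mul, Complex.norm_real, mul_left_comm]
    refine mul_le_mul_of_nonneg_left ((abs_poisson_le hv0 t).trans ?_) (norm_nonneg _)
    gcongr
    · exact hv.2.le
    · exact hv.1.le
  · simpa only [norm_mul_weight] using hf.norm.const_mul _
  · have hden : u ^ 2 + t ^ 2 ≠ 0 := by positivity
    have : ContinuousAt (fun u => poisson u t) u := by
      unfold poisson
      exact continuousAt_const.mul (continuousAt_id.div (by fun_prop) hden)
    exact continuousAt_const.mul (Complex.continuous_ofReal.continuousAt.comp this)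

end Orbit

theorem poisson_neg (u t : ℝ) : poisson u (-t) = poisson u t := by simp [poisson]

theorem convolutionExistsAt_of_integrable_restrict {f : G → ℂ} {ω : G} {u t : ℝ}
    (h : Integrable fun x => restrict β f (ω * β (Multiplicative.ofAdd t)) x * (poisson u x : ℂ)) :
    ConvolutionExistsAt (restrict β f ω) (fun x : ℝ => (poisson u x : ℂ)) t
      (ContinuousLinearMap.mul ℝ ℂ) volume := by
  simp only [restrict_mul] at h
  refine (h.comp_add_left (-t)).congr (.of_forall fun x => ?_)
  simp only [ContinuousLinearMap.mul_apply', add_neg_cancel_left]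
  rw [← poisson_neg]
  congr 3
  ring

theorem convolution_restrict_poisson (f : G → ℂ) (ω : G) (u t : ℝ) :
    convolution (restrict β f ω) (fun x : ℝ => (poisson u x : ℂ))
      (ContinuousLinearMap.mul ℝ ℂ) volume t =
      lineConv β f (fun x => (poisson u x : ℂ)) (ω * β (Multiplicative.ofAdd t)) := by
  rw [convolution_def, lineConv, ← integral_add_left_eq_self _ t]
  congr 1 with x
  rw [restrict_mul, ContinuousLinearMap.mul_apply', ← poisson_neg u x]
  congr 3
  ring

end Orbits

/-! ### Almost everywhere bounds and the Poisson formula for vertical limits. -/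

section VerticalLimits

variable {G : Type*} [CommGroup G] [TopologicalSpace G] {lam : ℕ → ℝ} {β : Multiplicative ℝ →* G}

theorem verticalLimit_mul (hβ : IsFreqDirichletGroup lam β) (a : ℕ → ℂ) (ω : G) (t : ℝ) (n : ℕ) :
    verticalLimit hβ a (ω * β (Multiplicative.ofAdd t)) n =
      verticalLimit hβ a ω n * Complex.exp (-Complex.I * lam n * t) := by
  rw [verticalLimit, verticalLimit, map_mul, Circle.coe_mul, freqChar_restrictsTo hβ n t,
    ← mul_assoc]

/-- Moving ω along its orbit is a vertical translation of the variable, so the point u + it for ω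
reduces to the real point u for ωβ(t). -/
theorem seriesConvergesTo_verticalLimit_mul (hβ : IsFreqDirichletGroup lam β) (a : ℕ → ℂ) (ω : G)
    (t : ℝ) (s l : ℂ) :
    SeriesConvergesTo lam (verticalLimit hβ a (ω * β (Multiplicative.ofAdd t))) s l ↔
      SeriesConvergesTo lam (verticalLimit hβ a ω) (s + Complex.I * t) l := by
  have : ∀ n, verticalLimit hβ a (ω * β (Multiplicative.ofAdd t)) n *
      Complex.exp (-(lam n : ℂ) * s) =
      verticalLimit hβ a ω n * Complex.exp (-(lam n : ℂ) * (s + Complex.I * t)) := fun n => by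
    rw [verticalLimit_mul, mul_assoc, ← Complex.exp_add]
    congr 2
    ring
  simp only [SeriesConvergesTo, this]

variable [IsTopologicalGroup G] [CompactSpace G] [MeasurableSpace G] [BorelSpace G]

theorem ae_integrable_restrict_mul_weight (hβ : Continuous β) {f : G → ℂ}
    (hf : Integrable f (haarProb G)) :
    ∀ᵐ ω ∂(haarProb G), Integrable fun t => restrict β f ω t * (weight t : ℂ) :=
  (integrable_restrict_mul hβ hf integrable_weight.ofReal).prod_left_ae

theorem integrable_majorant (hβ : Continuous β) {f : G → ℂ} (hf : Integrable f (haarProb G)) :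
    Integrable (majorant β f) (haarProb G) := by
  have := (integrable_restrict_mul hβ hf integrable_weight.ofReal).norm.integral_prod_right
  simpa only [Complex.coe_algebraMap, RCLike.ofReal_eq_complex_ofReal, norm_mul_weight] using! this

variable [T2Space G]

/-- M is chosen before ω: all dependence on ω sits in the integrable `majorant`, as dominated
convergence over G needs later. -/
theorem ae_norm_sum_verticalLimit_le (hlam : IsFrequency lam) (hLC : LandauCondition lam)
    (hβ : IsFreqDirichletGroup lam β) {a : ℕ → ℂ} {f : G → ℂ} (hf : IsAssociated hβ a f)
    {δ : ℝ} (hδ : 0 < δ) : ∃ M, 0 ≤ M ∧ ∀ᵐ ω ∂(haarProb G), ∀ N,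
      ‖∑ n ∈ Finset.range (N + 1), verticalLimit hβ a ω n‖ ≤
        M * majorant β f ω * Real.exp (δ * lam N) := by
  obtain ⟨M, hM, hK⟩ := exists_partialSum_kernel hlam hLC hδ
  refine ⟨M, hM, ae_all_iff.2 fun N => ?_⟩
  obtain ⟨K, hKm, hKle, hKhat⟩ := hK N
  have hKi : Integrable K :=
    (integrable_weight.const_mul _).mono' hKm.aestronglyMeasurable (.of_forall hKle)
  have hfi := memLp_one_iff_integrable.1 hf.mem.memLp
  filter_upwards [sum_verticalLimit_ae_eq_lineConv hlam hβ hf hKi (N := N + 1)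
    (by simpa only [Nat.lt_succ_iff] using hKhat),
    ae_integrable_restrict_mul_weight hβ.continuous hfi] with ω h1 h2
  rw [h1]
  refine (norm_lineConv_le h2 hKle).trans_eq ?_
  ring

/-- Both sides are integrable on G with the same Fourier coefficients: those of the sum come from
its partial sums by dominated convergence, those of the Poisson integral from `poisson_fourier`,
where |λ_m| = λ_m. -/
theorem ae_tsum_abelTerm_eq (hlam : IsFrequency lam) (hLC : LandauCondition lam)
    (hβ : IsFreqDirichletGroup lam β) {a : ℕ → ℂ} {f : G → ℂ} (hf : IsAssociated hβ a f)
    {u : ℝ} (hu : 0 < u) : ∀ᵐ ω ∂(haarProb G),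
      ∑' n, abelTerm lam (verticalLimit hβ a ω) u n =
        lineConv β f (fun t => (poisson u t : ℂ)) ω := by
  have hfi := memLp_one_iff_integrable.1 hf.mem.memLp
  obtain ⟨M, hM, hle⟩ := ae_norm_sum_verticalLimit_le hlam hLC hβ hf (half_pos hu)
  let b : ℕ → ℂ := fun n => a n * Complex.exp (-(lam n : ℂ) * u)
  let S : ℕ → G → ℂ := fun N ω => ∑ n ∈ Finset.range N, b n * (freqChar hβ n ω : ℂ)
  have hS : ∀ N ω, S N ω = ∑ n ∈ Finset.range N,
      verticalLimit hβ a ω n * Complex.exp (-(lam n : ℂ) * u) := fun N ω =>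
    Finset.sum_congr rfl fun n _ => by simp only [b, verticalLimit]; ring
  have hs : 2 * (u / 2) ≤ (u : ℂ).re := by simp; linarith
  have hSlim : ∀ᵐ ω ∂(haarProb G), Tendsto (fun N => S N ω) atTop
      (𝓝 (∑' n, abelTerm lam (verticalLimit hβ a ω) u n)) := by
    filter_upwards [hle] with ω hω
    simp only [hS]
    exact seriesConvergesTo_tsum_abelTerm hlam (half_pos hu)
      (mul_nonneg hM (majorant_nonneg β f ω)) hω hs
  have hSle : ∀ N, ∀ᵐ ω ∂(haarProb G),
      ‖S N ω‖ ≤ M * majorant β f ω * (1 + ‖(u : ℂ)‖ / (u / 2)) := fun N => by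
    filter_upwards [hle] with ω hω
    rw [hS]
    exact norm_partialSum_le hlam (half_pos hu) (mul_nonneg hM (majorant_nonneg β f ω)) hω hs N
  have hSint := integrable_sum_freqChar hβ b
  have hbound : Integrable (fun ω => M * majorant β f ω * (1 + ‖(u : ℂ)‖ / (u / 2)))
      (haarProb G) := ((integrable_majorant hβ.continuous hfi).const_mul M).mul_const _
  have hLint : Integrable (fun ω => ∑' n, abelTerm lam (verticalLimit hβ a ω) u n)
      (haarProb G) := by
    refine hbound.mono' (aestronglyMeasurable_of_tendsto_ae atTop
      (fun N => (hSint N).aestronglyMeasurable) hSlim) ?_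
    filter_upwards [hSlim, ae_all_iff.2 hSle] with ω h1 h2
    exact le_of_tendsto' h1.norm h2
  have hP : Integrable fun t => (poisson u t : ℂ) :=
    ((integrable_weight.const_mul _).mono' (measurable_poisson u).aestronglyMeasurable
      (.of_forall (abs_poisson_le hu))).ofReal
  refine ae_eq_of_fourierCoeff hLint (integrable_lineConv hβ.continuous hfi hP) fun χ => ?_
  have hlim : Tendsto (fun N => fourierCoeff (S N) χ) atTop
      (𝓝 (fourierCoeff (fun ω => ∑' n, abelTerm lam (verticalLimit hβ a ω) u n) χ)) := by
    have hχ : Continuous fun ω => starRingEnd ℂ (χ ω : ℂ) := by fun_prop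
    refine tendsto_integral_of_dominated_convergence _
      (fun N => (hSint N).aestronglyMeasurable.mul hχ.aestronglyMeasurable) hbound (fun N => ?_) ?_
    · filter_upwards [hSle N] with ω hω
      rwa [norm_mul, RCLike.norm_conj, Circle.norm_coe, mul_one]
    · filter_upwards [hSlim] with ω hω
      exact hω.mul_const _
  refine tendsto_nhds_unique hlim ?_
  by_cases hχ : χ ∈ Set.range (freqChar hβ)
  · obtain ⟨m, rfl⟩ := hχ
    rw [fourierCoeff_lineConv_freqChar hβ hfi hP, poisson_fourier hu, ← hf.coeff]
    refine tendsto_const_nhds.congr' ?_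
    filter_upwards [eventually_gt_atTop m] with N hN
    rw [fourierCoeff_sum_freqChar_apply hlam, if_pos hN, abs_of_nonneg (hlam.nonneg m)]
    simp only [b]
    push_cast
    congr 2
    ring
  · rw [fourierCoeff_lineConv_of_notMem hβ hf.mem hP hχ]
    exact tendsto_const_nhds.congr fun N => (fourierCoeff_sum_freqChar_of_notMem hβ b N hχ).symm

theorem ae_forall_norm_sum_verticalLimit_le (hlam : IsFrequency lam) (hLC : LandauCondition lam)
    (hβ : IsFreqDirichletGroup lam β) {a : ℕ → ℂ} {f : G → ℂ} (hf : IsAssociated hβ a f) :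
    ∀ᵐ ω ∂(haarProb G), ∀ δ > 0, ∃ M, 0 ≤ M ∧ ∀ N,
      ‖∑ n ∈ Finset.range (N + 1), verticalLimit hβ a ω n‖ ≤ M * Real.exp (δ * lam N) := by
  have h : ∀ᵐ ω ∂(haarProb G), ∀ m : ℕ, ∃ M, 0 ≤ M ∧ ∀ N,
      ‖∑ n ∈ Finset.range (N + 1), verticalLimit hβ a ω n‖ ≤
        M * Real.exp (1 / (m + 1) * lam N) := ae_all_iff.2 fun m => by
    obtain ⟨M, hM, hle⟩ := ae_norm_sum_verticalLimit_le hlam hLC hβ hf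
      (Nat.one_div_pos_of_nat (α := ℝ) (n := m))
    exact hle.mono fun ω hω => ⟨_, mul_nonneg hM (majorant_nonneg β f ω), hω⟩
  filter_upwards [h] with ω hω δ hδ
  obtain ⟨m, hm⟩ := exists_nat_one_div_lt hδ
  obtain ⟨M, hM, hle⟩ := hω m
  refine ⟨M, hM, fun N => (hle N).trans ?_⟩
  have := hlam.nonneg N
  gcongr

/-- Countably many null sets handle rational u, and both sides are continuous in u, so one null set
serves every u > 0. -/
theorem ae_forall_tsum_abelTerm_eq (hlam : IsFrequency lam) (hLC : LandauCondition lam)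
    (hβ : IsFreqDirichletGroup lam β) {a : ℕ → ℂ} {f : G → ℂ} (hf : IsAssociated hβ a f) :
    ∀ᵐ ω ∂(haarProb G), ∀ u : ℝ, 0 < u → ∑' n, abelTerm lam (verticalLimit hβ a ω) u n =
        lineConv β f (fun t => (poisson u t : ℂ)) ω := by
  have hrat : ∀ᵐ ω ∂(haarProb G), ∀ q : ℚ, 0 < (q : ℝ) →
      ∑' n, abelTerm lam (verticalLimit hβ a ω) ((q : ℝ) : ℂ) n =
        lineConv β f (fun t => (poisson q t : ℂ)) ω :=
    ae_all_iff.2 fun q => Filter.eventually_imp_distrib_left.2 fun hq =>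
      ae_tsum_abelTerm_eq hlam hLC hβ hf hq
  filter_upwards [hrat, ae_forall_norm_sum_verticalLimit_le hlam hLC hβ hf,
    ae_integrable_restrict_mul_weight hβ.continuous (memLp_one_iff_integrable.1 hf.mem.memLp)]
    with ω h1 h2 h3 u hu
  refine tendsto_nhds_unique_of_frequently_eq (continuousAt_tsum_abelTerm hlam hu h2)
    (continuousAt_lineConv_poisson h3 hu) ?_
  have hfreq : ∃ᶠ v : ℝ in 𝓝 u, v ∈ Set.range ((↑) : ℚ → ℝ) :=
    mem_closure_iff_frequently.1 (Rat.denseRange_cast u)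
  refine (hfreq.and_eventually (lt_mem_nhds hu)).mono ?_
  rintro _ ⟨⟨q, rfl⟩, hq⟩
  exact h1 q hq

end VerticalLimits

/-! ### Assembly of the null set. -/

section Main

/-- Outside a null set, the vertical limits converge on the right half-plane and are given there by
Poisson integrals. -/
theorem exists_null_set_forall_notMem {G : Type*} [CommGroup G] [TopologicalSpace G]
    [IsTopologicalGroup G] [CompactSpace G] [T2Space G] [MeasurableSpace G] [BorelSpace G]
    {lam : ℕ → ℝ} (hlam : IsFrequency lam) (hLC : LandauCondition lam)
    {β : Multiplicative ℝ →* G} (hβ : IsFreqDirichletGroup lam β)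
    {a : ℕ → ℂ} {f : G → ℂ} (hf : IsAssociated hβ a f) :
      ∃ N : Set G, haarProb G N = 0 ∧ ∀ ω : G, ω ∉ N →
        ConvergesOnRightHalfPlane lam (verticalLimit hβ a ω) ∧
        LocallyIntegrable (restrict β f ω) volume ∧
        ∀ u : ℝ, 0 < u → ∀ᵐ t : ℝ,
          ConvolutionExistsAt (restrict β f ω)
            (fun x : ℝ => (poisson u x : ℂ)) t
            (ContinuousLinearMap.mul ℝ ℂ) volume ∧
          SeriesConvergesTo lam (verticalLimit hβ a ω)
            ((u : ℂ) + Complex.I * (t : ℂ))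
            (convolution (restrict β f ω)
              (fun x : ℝ => (poisson u x : ℂ))
              (ContinuousLinearMap.mul ℝ ℂ) volume t) := by
  have hgood := (ae_forall_norm_sum_verticalLimit_le hlam hLC hβ hf).and
    ((ae_integrable_restrict_mul_weight hβ.continuous
      (memLp_one_iff_integrable.1 hf.mem.memLp)).and
      (ae_forall_tsum_abelTerm_eq hlam hLC hβ hf))
  -- Goodness at ω gives convergence and local integrability; goodness at ωβ(t) for almost every t
  -- gives the Poisson formula at u + it.
  have hall := hgood.and (ae_ae_shift hβ.continuous hgood)
  have hconv : ∀ ω : G, (∀ δ > 0, ∃ M, 0 ≤ M ∧ ∀ N,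
      ‖∑ n ∈ Finset.range (N + 1), verticalLimit hβ a ω n‖ ≤ M * Real.exp (δ * lam N)) →
      ∀ s : ℂ, 0 < s.re → SeriesConvergesTo lam (verticalLimit hβ a ω) s
        (∑' n, abelTerm lam (verticalLimit hβ a ω) s n) := fun ω h s hs => by
    obtain ⟨M, hM, hle⟩ := h (s.re / 2) (half_pos hs)
    exact seriesConvergesTo_tsum_abelTerm hlam (half_pos hs) hM hle (by linarith)
  refine ⟨_, ae_iff.1 hall, fun ω hω => ?_⟩
  obtain ⟨⟨h1, h2, -⟩, h4⟩ := not_not.1 hω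
  refine ⟨fun s hs => ⟨_, hconv ω h1 s hs⟩, locallyIntegrable_restrict h2, fun u hu => ?_⟩
  filter_upwards [h4] with t ⟨ht1, ht2, ht3⟩
  refine ⟨convolutionExistsAt_of_integrable_restrict (integrable_restrict_mul_poisson ht2 hu), ?_⟩
  rw [convolution_restrict_poisson, ← ht3 u hu, ← seriesConvergesTo_verticalLimit_mul]
  exact hconv _ ht1 u (by simpa using hu)

end Main

end GenDirichlet

end

theorem mainTheorem4 {G : Type*} [CommGroup G] [TopologicalSpace G] [IsTopologicalGroup G]
    [CompactSpace G] [T2Space G] [MeasurableSpace G] [BorelSpace G]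
    (lam : ℕ → ℝ) (_hlam : GenDirichlet.IsFrequency lam)
    (_hLC : GenDirichlet.LandauCondition lam)
    (β : Multiplicative ℝ →* G) (hβ : GenDirichlet.IsFreqDirichletGroup lam β)
    (a : ℕ → ℂ) (_ha : a ∈ GenDirichlet.dirichletHardyOne hβ) :
    (∀ᵐ ω ∂(GenDirichlet.haarProb G),
      GenDirichlet.ConvergesOnRightHalfPlane lam (GenDirichlet.verticalLimit hβ a ω)) ∧
    ∀ f : G → ℂ, GenDirichlet.IsAssociated hβ a f →
      ∃ N : Set G, GenDirichlet.haarProb G N = 0 ∧ ∀ ω : G, ω ∉ N →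
        GenDirichlet.ConvergesOnRightHalfPlane lam (GenDirichlet.verticalLimit hβ a ω) ∧
        LocallyIntegrable (GenDirichlet.restrict β f ω) volume ∧
        ∀ u : ℝ, 0 < u → ∀ᵐ t : ℝ,
          ConvolutionExistsAt (GenDirichlet.restrict β f ω)
            (fun x : ℝ => (GenDirichlet.poisson u x : ℂ)) t
            (ContinuousLinearMap.mul ℝ ℂ) volume ∧
          GenDirichlet.SeriesConvergesTo lam (GenDirichlet.verticalLimit hβ a ω)
            ((u : ℂ) + Complex.I * (t : ℂ))
            (convolution (GenDirichlet.restrict β f ω)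
              (fun x : ℝ => (GenDirichlet.poisson u x : ℂ))
              (ContinuousLinearMap.mul ℝ ℂ) volume t) := by
  have h : ∀ f : G → ℂ, GenDirichlet.IsAssociated hβ a f → _ := fun f hf =>
    GenDirichlet.exists_null_set_forall_notMem _hlam _hLC hβ hf
  refine ⟨?_, h⟩
  obtain ⟨f, hf⟩ := _ha
  obtain ⟨N, hN, hω⟩ := h f hf
  exact (measure_eq_zero_iff_ae_notMem.1 hN).mono fun ω hωN => (hω ω hωN).1
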